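/- **Setting.** Let $E$ be a real vector space of dimension $8$ with a negative definite scalar product $\langle\cdot,\cdot\rangle$, and let $\mathfrak m=E\oplus\mathbb R p\oplus\mathbb R q$ be the Minkowski space in which $\langle p,E\rangle=\langle q,E\rangle=\langle p,p\rangle=\langle q,q\rangle=0$ and $\langle p,q\rangle=1$. For $e\in E$ put $e^\flat=\langle e,\cdot\rangle|_E\in E^*$. Let $b$ be a non-degenerate symmetric bilinear form on $E$ and let $B\in\mathrm{End}_{\mathbb R}(E)$ be given by $b(e,f)=-\langle Be,f\rangle$; assume the normalization $\operatorname{tr}(B^2)=8$, i.e. the eigenvalues $b_i$ of $B$ satisfy $\sum_i b_i^2=8$. The Cahen–Wallach algebra $\mathfrak g_b=E^*\oplus E\oplus\mathbb R p\oplus\mathbb R q$ is the Lie algebra whose only non-trivial brackets are $$[q,e]=e^\flat,\qquad [e^\flat,f]=b(e,f)\,p,\qquad [e^\flat,q]=Be\qquad(e,f\in E).$$ Clifford algebras use the convention $v^2=-\langle v,v\rangle$. Let $\rho_{\rm spin}:\mathrm{Cl}(\mathfrak m)\to\mathrm{End}_{\mathbb R}(S)$ be an irreducible real representation. A Lie algebra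 representation $\rho:\mathfrak g_b\to\mathfrak{gl}_{\mathbb R}(S)$ is called *spin* if $\rho(e^\flat)=\rho_{\rm spin}(p\wedge Be)$ for all $e\in E$, where $v\wedge w=\frac14(vw-wv)\in\mathrm{Cl}(\mathfrak m)$; it has *non-zero charge* if $\rho(p)\neq0$. **Theorem 4.5.** $\mathfrak g_b$ admits a spin representation of non-zero charge on $S$ if and only if $B=\mathrm{Id}$ or $B=-\mathrm{Id}$. In that case such a representation is given explicitly as follows. Let $V$ be any irreducible real $\mathrm{Cl}(E)$-module. Then $S=V\oplus V$, written in columns, is an irreducible $\mathrm{Cl}(\mathfrak m)$-module via $$e\mapsto\begin{pmatrix}-e&0\\0&e\end{pmatrix},\qquad p\mapsto\begin{pmatrix}0&2\sqrt2\\0&0\end{pmatrix},\qquad q\mapsto\begin{pmatrix}0&0\\-\frac1{\sqrt2}&0\end{pmatrix}.$$ Let $\pi^\pm=\frac12(\mathrm{Id}\pm e_1\cdots e_8)\in\mathrm{End}_{\mathbb R}(V)$ be the projections on the semi-spinors, where $e_1,\dots,e_8$ is any basis of $E$ that is orthonormal for $-\langle\cdot,\cdot\rangle$. If $B=\varepsilon\,\mathrm{Id}$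 with $\varepsilon\in\{1,-1\}$, then $$\rho(e^\flat)=\sqrt2\begin{pmatrix}0&Be\\0&0\end{pmatrix},\quad \rho(e)=\sqrt2\begin{pmatrix}-e\circ\pi^-&0\\0&e\circ\pi^+\end{pmatrix},\quad \rho(p)=4\begin{pmatrix}0&\pi^+\\0&0\end{pmatrix},\quad \rho(q)=\begin{pmatrix}0&\varepsilon\,\mathrm{Id}\\-\pi^-&0\end{pmatrix}$$ defines a spin representation of $\mathfrak g_b$ on $S$ of non-zero charge. -/

import Mathlib

open Module

attribute [local instance 100] LieRing.ofAssociativeRing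

namespace CahenWallach

noncomputable section

section Minkowski

variable (E : Type*) [NormedAddCommGroup E] [InnerProductSpace ℝ E]

/-- The negative definite scalar product `⟨e, f⟩ = -(e, f)` on the Euclidean space `E`. -/
def scalarE : LinearMap.BilinForm ℝ E := -(innerₗ E)

variable {E} in
@[simp] theorem scalarE_apply (e f : E) : scalarE E e f = -inner ℝ e f := rfl

theorem scalarE_nondegenerate : (scalarE E).Nondegenerate := by
  constructor
  · intro x h
    have := h x
    simpa using this
  · intro x h
    have := h x
    simpa using this

/-- The Minkowski space `𝔪 = E ⊕ ℝ𝐩 ⊕ ℝ𝐪`; the triple `(e, s, t)` stands for `e + s𝐩 + t𝐪`. -/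
abbrev Minkowski : Type _ := E × ℝ × ℝ

/-- The Lorentzian scalar product of signature `(+, -, …, -)` on `𝔪`: negative definite on `E`,
with `𝐩, 𝐪` isotropic, orthogonal to `E`, and `⟨𝐩, 𝐪⟩ = 1`. -/
def scalarM : LinearMap.BilinForm ℝ (Minkowski E) :=
  LinearMap.mk₂ ℝ (fun v w => scalarE E v.1 w.1 + v.2.1 * w.2.2 + v.2.2 * w.2.1)
    (by intro v v' w; simp only [Prod.fst_add, Prod.snd_add, map_add, LinearMap.add_apply]; ring)
    (by intro c v w; simp only [Prod.smul_fst, Prod.smul_snd, map_smul, LinearMap.smul_apply,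
          smul_eq_mul]; ring)
    (by intro v w w'; simp only [Prod.fst_add, Prod.snd_add, map_add]; ring)
    (by intro c v w; simp only [Prod.smul_fst, Prod.smul_snd, map_smul, smul_eq_mul]; ring)

/-- The Clifford algebra `Cl(E)`, with the sign convention `v * v = -⟨v, v⟩`. -/
abbrev ClE : Type _ := CliffordAlgebra (-(scalarE E).toQuadraticMap)

/-- The Clifford algebra `Cl(𝔪)`, with the sign convention `v * v = -⟨v, v⟩`. -/
abbrev ClM : Type _ := CliffordAlgebra (-(scalarM E).toQuadraticMap)

variable {E}

/-- The inclusion of `E` into `Cl(E)`. -/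
def inE : E →ₗ[ℝ] ClE E := CliffordAlgebra.ι _

/-- The inclusion of `𝔪` into `Cl(𝔪)`. -/
def inM : Minkowski E →ₗ[ℝ] ClM E := CliffordAlgebra.ι _

/-- The isotropic vector `𝐩 ∈ 𝔪`. -/
def vecP : Minkowski E := (0, 1, 0)

/-- The image `¼ [v, w]` in `Cl(𝔪)` of the element
`v ∧ w = ⟨v, ·⟩ w - ⟨w, ·⟩ v` of `𝔰𝔬(𝔪)`. -/
def wedge (v w : Minkowski E) : ClM E :=
  (1 / 4 : ℝ) • (inM v * inM w - inM w * inM v)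

end Minkowski

section Representations

variable {A S : Type*} [Ring A] [Algebra ℝ A] [AddCommGroup S] [Module ℝ S]

/-- A representation `γ` of the real algebra `A` on the real vector space `S` is irreducible:
`S ≠ 0` and there are no invariant subspaces besides `0` and `S`. -/
def IsIrreducible (γ : A →ₐ[ℝ] End ℝ S) : Prop :=
  Nontrivial S ∧ ∀ W : Submodule ℝ S, (∀ a : A, ∀ x ∈ W, γ a x ∈ W) → W = ⊥ ∨ W = ⊤

/-- The endomorphism of `S ⊕ S` with block matrix `(a b; c d)`, acting on columns. -/
def block (a b c d : End ℝ S) : End ℝ (S × S) :=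
  (a.coprod b).prod (c.coprod d)

@[simp] theorem block_apply (a b c d : End ℝ S) (x : S × S) :
    block a b c d x = (a x.1 + b x.2, c x.1 + d x.2) := rfl

end Representations

section Algebra

variable (E : Type*) [NormedAddCommGroup E] [InnerProductSpace ℝ E]

/-- A non-degenerate symmetric bilinear form `b` on `E`. -/
structure CWForm where
  /-- the bilinear form -/
  form : LinearMap.BilinForm ℝ E
  symm : form.IsSymm
  nondegenerate : form.Nondegenerate

variable {E}

/-- The underlying vector space `E* ⊕ E ⊕ ℝ𝐩 ⊕ ℝ𝐪` of the Cahen-Wallach algebra `𝔤_b`. -/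
def CWAlgebra (_b : CWForm E) : Type _ := Dual ℝ E × E × ℝ × ℝ

namespace CWAlgebra

variable {b : CWForm E}

instance : AddCommGroup (CWAlgebra b) := inferInstanceAs (AddCommGroup (Dual ℝ E × E × ℝ × ℝ))

instance : Module ℝ (CWAlgebra b) := inferInstanceAs (Module ℝ (Dual ℝ E × E × ℝ × ℝ))

/-- The element `ξ + e + s𝐩 + t𝐪` of `𝔤_b`. -/
def mk (ξ : Dual ℝ E) (e : E) (s t : ℝ) : CWAlgebra b := (ξ, e, s, t)

/-- The `E*`-component. -/
def dual (x : CWAlgebra b) : Dual ℝ E := x.1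
/-- The `E`-component. -/
def vec (x : CWAlgebra b) : E := x.2.1
/-- The `𝐩`-coordinate. -/
def pc (x : CWAlgebra b) : ℝ := x.2.2.1
/-- The `𝐪`-coordinate. -/
def qc (x : CWAlgebra b) : ℝ := x.2.2.2

@[ext] theorem ext {x y : CWAlgebra b} (h1 : x.dual = y.dual) (h2 : x.vec = y.vec)
    (h3 : x.pc = y.pc) (h4 : x.qc = y.qc) : x = y :=
  Prod.ext h1 (Prod.ext h2 (Prod.ext h3 h4))

@[simp] theorem dual_mk (ξ : Dual ℝ E) (e : E) (s t : ℝ) : (mk ξ e s t : CWAlgebra b).dual = ξ := rfl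
@[simp] theorem vec_mk (ξ : Dual ℝ E) (e : E) (s t : ℝ) : (mk ξ e s t : CWAlgebra b).vec = e := rfl
@[simp] theorem pc_mk (ξ : Dual ℝ E) (e : E) (s t : ℝ) : (mk ξ e s t : CWAlgebra b).pc = s := rfl
@[simp] theorem qc_mk (ξ : Dual ℝ E) (e : E) (s t : ℝ) : (mk ξ e s t : CWAlgebra b).qc = t := rfl
@[simp] theorem dual_add (x y : CWAlgebra b) : (x + y).dual = x.dual + y.dual := rfl
@[simp] theorem vec_add (x y : CWAlgebra b) : (x + y).vec = x.vec + y.vec := rfl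
@[simp] theorem pc_add (x y : CWAlgebra b) : (x + y).pc = x.pc + y.pc := rfl
@[simp] theorem qc_add (x y : CWAlgebra b) : (x + y).qc = x.qc + y.qc := rfl
@[simp] theorem dual_smul (c : ℝ) (x : CWAlgebra b) : (c • x).dual = c • x.dual := rfl
@[simp] theorem vec_smul (c : ℝ) (x : CWAlgebra b) : (c • x).vec = c • x.vec := rfl
@[simp] theorem pc_smul (c : ℝ) (x : CWAlgebra b) : (c • x).pc = c * x.pc := rfl
@[simp] theorem qc_smul (c : ℝ) (x : CWAlgebra b) : (c • x).qc = c * x.qc := rfl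
@[simp] theorem dual_zero : (0 : CWAlgebra b).dual = 0 := rfl
@[simp] theorem vec_zero : (0 : CWAlgebra b).vec = 0 := rfl
@[simp] theorem pc_zero : (0 : CWAlgebra b).pc = 0 := rfl
@[simp] theorem qc_zero : (0 : CWAlgebra b).qc = 0 := rfl

end CWAlgebra

variable [FiniteDimensional ℝ E]

variable (E) in
/-- The musical isomorphism `e ↦ e♭ = ⟨e, ·⟩|_E`; its inverse is `♯`. -/
def flat : E ≃ₗ[ℝ] Dual ℝ E := (scalarE E).toDual (scalarE_nondegenerate E)

/-- The symmetric endomorphism `B` of `E` with `b(e, f) = -⟨B e, f⟩`. -/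
def CWForm.endo (b : CWForm E) : End ℝ E := -((flat E).symm.toLinearMap ∘ₗ b.form)

theorem CWForm.form_eq (b : CWForm E) (e f : E) : b.form e f = -scalarE E (b.endo e) f := by
  have h : scalarE E ((flat E).symm (b.form e)) f = b.form e f :=
    LinearMap.BilinForm.apply_toDual_symm_apply (hB := scalarE_nondegenerate E) _ _
  rw [← h]
  simp only [CWForm.endo, LinearMap.neg_apply, LinearMap.comp_apply, LinearEquiv.coe_coe, map_neg,
    neg_neg]

namespace CWAlgebra

variable {b : CWForm E}

/-- The bracket of `𝔤_b`, with non-trivial relations `[𝐪, e] = e♭`, `[e♭, f] = b(e, f) 𝐩`,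
`[e♭, 𝐪] = B e`. -/
instance : Bracket (CWAlgebra b) (CWAlgebra b) where
  bracket x y := mk
    (x.qc • flat E y.vec - y.qc • flat E x.vec)
    (y.qc • b.endo ((flat E).symm x.dual) - x.qc • b.endo ((flat E).symm y.dual))
    (b.form ((flat E).symm x.dual) y.vec - b.form ((flat E).symm y.dual) x.vec)
    0

theorem bracket_def (x y : CWAlgebra b) : ⁅x, y⁆ = mk
    (x.qc • flat E y.vec - y.qc • flat E x.vec)
    (y.qc • b.endo ((flat E).symm x.dual) - x.qc • b.endo ((flat E).symm y.dual))
    (b.form ((flat E).symm x.dual) y.vec - b.form ((flat E).symm y.dual) x.vec)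
    0 := rfl

instance : LieRing (CWAlgebra b) where
  add_lie x y z := by
    ext1 <;> simp [bracket_def, add_smul] <;> abel
  lie_add x y z := by
    ext1 <;> simp [bracket_def, add_smul] <;> abel
  lie_self x := by
    ext1 <;> simp [bracket_def]
  leibniz_lie x y z := by
    have hs : ∀ u v : E, b.form u (b.endo v) = b.form v (b.endo u) := by
      intro u v
      rw [b.form_eq, b.form_eq, scalarE_apply, scalarE_apply, real_inner_comm]
    ext1
    · simp [bracket_def, smul_sub, smul_smul, mul_comm]
    · simp [bracket_def, smul_sub, smul_smul, mul_comm]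
    · simp only [bracket_def, dual_mk, vec_mk, pc_mk, qc_mk, pc_add, map_sub, map_smul,
        LinearMap.sub_apply, LinearMap.smul_apply, smul_eq_mul, LinearEquiv.symm_apply_apply]
      rw [hs ((flat E).symm y.dual) ((flat E).symm x.dual),
        hs ((flat E).symm z.dual) ((flat E).symm x.dual),
        hs ((flat E).symm z.dual) ((flat E).symm y.dual), b.symm.eq x.vec y.vec,
        b.symm.eq x.vec z.vec, b.symm.eq y.vec z.vec]
      ring
    · simp [bracket_def]

instance : LieAlgebra ℝ (CWAlgebra b) where
  lie_smul c x y := by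
    ext1 <;> simp [bracket_def, smul_sub, smul_smul, mul_comm]
    ring

/-- The inclusion of `E* = 𝔥`. -/
def ofDual (ξ : Dual ℝ E) : CWAlgebra b := mk ξ 0 0 0
/-- The inclusion of `E`. -/
def ofVec (e : E) : CWAlgebra b := mk 0 e 0 0
variable (b) in
/-- The central element `𝐩`. -/
def p : CWAlgebra b := mk 0 0 1 0
variable (b) in
/-- The element `𝐪`. -/
def q : CWAlgebra b := mk 0 0 0 1

end CWAlgebra

/-- Given a Clifford representation `ρ_spin : Cl(𝔪) → End(S)`, a representation `ρ` of `𝔤_b` on `S`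
is spin if it restricts on `E*` to `ρ_spin` composed with the isotropy representation
`e♭ ↦ 𝐩 ∧ B e ∈ 𝔰𝔬(𝔪) ⊆ Cl(𝔪)`. -/
def IsSpin {b : CWForm E} {S : Type*} [AddCommGroup S] [Module ℝ S]
    (ρspin : ClM E →ₐ[ℝ] End ℝ S) (ρ : CWAlgebra b →ₗ⁅ℝ⁆ End ℝ S) : Prop :=
  ∀ e : E, ρ (CWAlgebra.ofDual (flat E e)) = ρspin (wedge vecP (b.endo e, 0, 0))

/-- The Cahen-Wallach algebra `𝔤_b` has a spin representation of non-zero charge on the Clifford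
module `S`, that is, one with `ρ(𝐩) ≠ 0`. -/
def HasNonzeroChargeSpinRep (b : CWForm E) {S : Type*} [AddCommGroup S] [Module ℝ S]
    (ρspin : ClM E →ₐ[ℝ] End ℝ S) : Prop :=
  ∃ ρ : CWAlgebra b →ₗ⁅ℝ⁆ End ℝ S, IsSpin ρspin ρ ∧ ρ (CWAlgebra.p b) ≠ 0

end Algebra

section Model

variable {E : Type*} [NormedAddCommGroup E] [InnerProductSpace ℝ E]
variable {V : Type*} [AddCommGroup V] [Module ℝ V]

/-- Clifford multiplication by vectors of `𝔪` on `S = S₋ ⊕ S₊ = V ⊕ V`, where `V` is a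
`Cl(E)`-module: `e ↦ (-e 0; 0 e)`, `𝐩 ↦ (0 2√2; 0 0)`, `𝐪 ↦ (0 0; -1/√2 0)`. -/
def modelVec (γ : ClE E →ₐ[ℝ] End ℝ V) : Minkowski E →ₗ[ℝ] End ℝ (V × V) where
  toFun v := block (-γ (inE v.1)) ((2 * √2 * v.2.1) • 1) ((-(1 / √2) * v.2.2) • 1) (γ (inE v.1))
  map_add' v w := by
    ext x <;> simp [mul_add, add_smul, add_comm]
  map_smul' c v := by
    ext x <;> simp [smul_smul, mul_left_comm]

theorem modelVec_sq (γ : ClE E →ₐ[ℝ] End ℝ V) (v : Minkowski E) :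
    modelVec γ v * modelVec γ v =
      algebraMap ℝ (End ℝ (V × V)) ((-(scalarM E).toQuadraticMap) v) := by
  have h : ∀ x : V, γ (inE v.1) (γ (inE v.1) x) = (-(scalarE E v.1 v.1)) • x := by
    intro x
    have h1 : inE v.1 * inE v.1 = algebraMap ℝ (ClE E) (-(scalarE E v.1 v.1)) :=
      CliffordAlgebra.ι_sq_scalar _ v.1
    have h2 := congrArg (fun c => γ c x) h1
    simpa only [map_mul, AlgHom.commutes, Module.End.mul_apply,
      Module.algebraMap_end_apply] using h2
  have h0 : √2 ≠ 0 := by positivity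
  have hQ : (-(scalarM E).toQuadraticMap) v = -(scalarE E v.1 v.1) - 2 * v.2.1 * v.2.2 := by
    simp [scalarM]
    ring
  have e1 : 2 * √2 * v.2.1 * ((√2)⁻¹ * v.2.2) = 2 * v.2.1 * v.2.2 := by
    field_simp
  have e2 : (√2)⁻¹ * v.2.2 * (2 * √2 * v.2.1) = 2 * v.2.1 * v.2.2 := by
    field_simp
  rw [hQ]
  refine LinearMap.ext fun x => ?_
  rw [Module.End.mul_apply, Module.algebraMap_end_apply]
  apply Prod.ext
  · simp [modelVec, h, smul_smul, sub_smul, e1]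
    abel
  · simp [modelVec, h, smul_smul, sub_smul, e2]
    abel

/-- The `Cl(𝔪)`-module `S = S₋ ⊕ S₊` built from a `Cl(E)`-module `V`. -/
def model (γ : ClE E →ₐ[ℝ] End ℝ V) : ClM E →ₐ[ℝ] End ℝ (V × V) :=
  CliffordAlgebra.lift _ ⟨modelVec γ, modelVec_sq γ⟩

/-- The projections `π⁺` (for `s = 1`) and `π⁻` (for `s = -1`) of `V` onto the `±1`-eigenspaces
(semi-spinors) of the volume element `e₁ ⋯ e₈` of an orthonormal basis. -/
def semiProj (γ : ClE E →ₐ[ℝ] End ℝ V) (u : OrthonormalBasis (Fin 8) ℝ E) (s : ℝ) : End ℝ V :=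
  (1 / 2 : ℝ) • (1 + s • γ (List.ofFn fun i => inE (u i)).prod)

end Model

end

end CahenWallach

/-! The isotropic vectors 𝐩, 𝐪 generate a system of 2 × 2 matrix units in `End S`, so every
endomorphism of `S` becomes a 2 × 2 matrix over the commutant of these units. After a sign twist,
`E` acts by scalar matrices `c v`, with `c v * c w + c w * c v = 2 (v, w)`. No classification of
Clifford modules is needed: irreducibility enters the necessity only through Schur's lemma, and
sufficiency needs only `S ≠ 0`.

Necessity. Write `ρ(𝐪) = (α β; γ δ)`. The spin condition and `[e♭, 𝐪] = B e` determine `ρ(e)` from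
`ρ(𝐪)`. Then `[e♭, f] = b(e, f) 𝐩` forces `ρ(𝐩) = (0 z; 0 0)`, and `v γ v = |v|² γ'` with `γ' =
-z/2`: every vector interchanges `γ` and `γ'`. Centrality of 𝐩 gives `γ γ' = γ' γ = 0`. By Schur's
lemma `T = γ + γ'` is zero or invertible, and the volume element excludes zero. Hence `π = T⁻¹ γ` is
an idempotent with `v π = (1 - π) v`; it plays the part of a semi-spinor projection
(`exists_idempotent_of_swap`).

The remaining relation `[𝐪, e] = e♭` expresses `B v` by `α, β, γ, δ`. Its two off-diagonal corners
with respect to `π` contain the same element `C`, up to conjugation by `T`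
(`exists_corner_of_relations`): `C v = π (B v)` and `v C = (B v) π`. Adding the two resulting
formulas for `C` gives `C = (v, B v) π` for each unit vector `v`. So `(v, B v)` is a constant `k`
and `B = k id` (`eq_smul_id_of_corner`). The normalization of the trace leaves `k = ±1`.

Sufficiency. For `B = ε id` the explicit matrices satisfy the bracket relations because the
semi-spinor projections are complementary and vectors exchange them
(`exists_lieHom_of_matrixUnits`). The charge is non-zero because `π⁺ = 0` would make a unit vector
act by zero (`chiralProj_mul_unit_ne_zero`). -/

namespace CahenWallach

/-! ### Clifford maps and the volume element in dimension 8. -/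

section CliffordMaps

variable {E : Type*} [NormedAddCommGroup E] [InnerProductSpace ℝ E]
variable {R : Type*} [Ring R] [Algebra ℝ R]

/-- Moving an element past a product of elements with which it commutes up to scalars. -/
theorem mul_list_prod_of_semiconj (x : R) (l : List (R × ℝ))
    (h : ∀ y ∈ l, x * y.1 = y.2 • (y.1 * x)) :
    x * (l.map Prod.fst).prod = (l.map Prod.snd).prod • ((l.map Prod.fst).prod * x) := by
  induction l with
  | nil => simp
  | cons y l ih =>
    have ih := ih fun y hy => h y (List.mem_cons_of_mem _ hy)
    have hy := h y List.mem_cons_self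
    simp only [List.map_cons, List.prod_cons]
    rw [← mul_assoc, hy, smul_mul_assoc, mul_assoc, ih, mul_smul_comm, smul_smul, mul_assoc]

/-- The square of a product of pairwise anticommuting involutions. -/
theorem list_prod_mul_self_of_anticommute (l : List R)
    (hsq : ∀ y ∈ l, y * y = 1) (hl : l.Pairwise fun x y => x * y = -(y * x)) :
    l.prod * l.prod = ((-1 : ℝ) ^ (l.length.choose 2)) • 1 := by
  induction l with
  | nil => simp
  | cons y l ih =>
    rw [List.pairwise_cons] at hl
    have ih := ih (fun z hz => hsq z (List.mem_cons_of_mem _ hz)) hl.2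
    have hy := hsq y List.mem_cons_self
    have key := mul_list_prod_of_semiconj y (l.map fun z => (z, (-1 : ℝ))) (by
      intro z hz
      obtain ⟨w, hw, rfl⟩ := List.mem_map.1 hz
      simpa using hl.1 w hw)
    simp only [List.map_map, Function.comp_def, List.map_id', List.map_const', List.prod_replicate]
      at key
    -- The new factor passes all `l.length` others, and Pascal's rule adds this exponent to
    -- `l.length.choose 2`.
    have h2 : y * l.prod * (y * l.prod) = (-1 : ℝ) ^ l.length • (l.prod * l.prod) := by
      nth_rewrite 1 [key]
      rw [smul_mul_assoc, mul_assoc, ← mul_assoc y, hy, one_mul]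
    rw [List.prod_cons, h2, ih, smul_smul, ← pow_add, List.length_cons, Nat.choose_succ_succ' _ 1,
      Nat.choose_one_right]

/-- A linear map `c` with `c v * c w + c w * c v = 2 (v, w)`. -/
def IsClifford (c : E →ₗ[ℝ] R) : Prop :=
  ∀ v w, c v * c w + c w * c v = (2 * inner ℝ v w) • (1 : R)

/-- The volume element `e₁ ⋯ e₈` of an orthonormal basis. -/
noncomputable def volumeElement (c : E →ₗ[ℝ] R) (u : OrthonormalBasis (Fin 8) ℝ E) : R :=
  (List.ofFn fun i => c (u i)).prod

variable {c : E →ₗ[ℝ] R}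

theorem IsClifford.mul_self (hc : IsClifford c) (v : E) :
    c v * c v = (inner ℝ v v : ℝ) • (1 : R) := by
  have h := hc v v
  rw [← two_smul ℝ, mul_smul] at h
  exact smul_right_injective R (two_ne_zero (α := ℝ)) h

theorem IsClifford.mul_self_of_unit (hc : IsClifford c) {v : E} (hv : ‖v‖ = 1) :
    c v * c v = 1 := by
  rw [hc.mul_self, real_inner_self_eq_norm_sq, hv]; simp

theorem IsClifford.anticomm (hc : IsClifford c) {v w : E} (h : inner ℝ v w = 0) :
    c v * c w = -(c w * c v) := by
  have := hc v w
  rw [h] at this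
  simp only [mul_zero, zero_smul] at this
  exact eq_neg_of_add_eq_zero_left this

variable (u : OrthonormalBasis (Fin 8) ℝ E)

/-- A basis vector commutes with itself and anticommutes with the other seven factors, an odd
number; linearity does the rest. -/
theorem IsClifford.mul_volumeElement (hc : IsClifford c) (v : E) :
    c v * volumeElement c u = -(volumeElement c u * c v) := by
  have key : ∀ j, c (u j) * volumeElement c u = -(volumeElement c u * c (u j)) := by
    intro j
    have := mul_list_prod_of_semiconj (c (u j))
      (List.ofFn fun i => (c (u i), if i = j then (1 : ℝ) else -1)) (by
      intro y hy
      obtain ⟨i, rfl⟩ := (List.mem_ofFn' _ _).1 hy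
      by_cases hij : i = j
      · simp [hij]
      · simpa [hij] using hc.anticomm (u.orthonormal.2 (Ne.symm hij)))
    rw [List.map_ofFn, List.map_ofFn, List.prod_ofFn (f := Prod.snd ∘ _)] at this
    have h8 : (∏ i : Fin 8, if i = j then (1 : ℝ) else -1) = -1 := by
      have (i : Fin 8) : (if i = j then (1 : ℝ) else -1) = (-1) * if i = j then -1 else 1 := by
        split_ifs <;> norm_num
      simp only [this, Finset.prod_mul_distrib, Finset.prod_const, Finset.prod_ite_eq',
        Finset.mem_univ, if_true, Finset.card_fin]
      norm_num
    simp only [Function.comp_def, h8, neg_smul, one_smul] at this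
    exact this
  rw [← u.sum_repr v]
  simp only [map_sum, map_smul, Finset.sum_mul, Finset.mul_sum, smul_mul_assoc, mul_smul_comm, key,
    ← Finset.sum_neg_distrib, smul_neg]

/-- The sign is `(-1) ^ 28`, since 8 choose 2 is 28. -/
theorem IsClifford.volumeElement_mul_self (hc : IsClifford c) :
    volumeElement c u * volumeElement c u = 1 := by
  have h := list_prod_mul_self_of_anticommute (List.ofFn fun i => c (u i))
    (by
      intro y hy
      obtain ⟨i, rfl⟩ := (List.mem_ofFn' _ _).1 hy
      exact hc.mul_self_of_unit (u.orthonormal.1 i))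
    (by
      rw [List.pairwise_ofFn]
      intro i j hij
      exact hc.anticomm (u.orthonormal.2 hij.ne))
  rw [volumeElement, h, List.length_ofFn]
  norm_num [Nat.choose]

end CliffordMaps

/-! ### The idempotent obtained from two elements interchanged by all vectors. -/

section Core

variable {E : Type*} [NormedAddCommGroup E] [InnerProductSpace ℝ E]
variable {R : Type*} [Ring R] [Algebra ℝ R] {c : E →ₗ[ℝ] R}

/-- An element `g` which is conjugated to `g'` by all unit vectors, with `g g' = g' g = 0`, is an
idempotent up to a unit of the commutant. -/
theorem exists_idempotent_of_swap (hc : IsClifford c) (u : OrthonormalBasis (Fin 8) ℝ E)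
    (K : Subalgebra ℝ R) (hcK : ∀ v, c v ∈ K)
    (hdiv : ∀ T ∈ K, (∀ v, T * c v = c v * T) → T = 0 ∨ IsUnit T)
    {g g' : R} (hg : g ∈ K) (hg0 : g' ≠ 0) (hgg' : g * g' = 0) (hg'g : g' * g = 0)
    (h1 : ∀ v, g * c v = c v * g') (h2 : ∀ v, g' * c v = c v * g) :
    ∃ T S π π' : R, T * S = 1 ∧ S * T = 1 ∧ π * π = π ∧ π + π' = 1 ∧ π ≠ 0 ∧
      (∀ v, T * c v = c v * T) ∧ T * π = π * T ∧ g = T * π ∧ g' = T * π' ∧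
      (∀ v, c v * π = π' * c v) := by
  have hu : c (u 0) * c (u 0) = 1 := hc.mul_self_of_unit (u.orthonormal.1 0)
  have hg'K : g' ∈ K := by
    have : g' = c (u 0) * g * c (u 0) := by
      rw [mul_assoc, h1, ← mul_assoc, hu, one_mul]
    rw [this]
    exact K.mul_mem (K.mul_mem (hcK _) hg) (hcK _)
  have hg0' : g ≠ 0 := by
    rintro rfl
    apply hg0
    have := h1 (u 0)
    rw [zero_mul] at this
    rw [← one_mul g', ← hu, mul_assoc, ← this, mul_zero]
  have hω := hc.volumeElement_mul_self u
  have hωK : volumeElement c u ∈ K := by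
    refine K.list_prod_mem fun y hy => ?_
    obtain ⟨i, rfl⟩ := (List.mem_ofFn' _ _).1 hy
    exact hcK _
  have hTc : ∀ v, (g + g') * c v = c v * (g + g') := by
    intro v
    rw [add_mul, h1, h2, mul_add, add_comm]
  -- The sum commutes with the vectors, since they swap its summands. If it vanishes, `g` is
  -- nilpotent and anticommutes with vectors, so `ω g` commutes with them and Schur applies once
  -- more.
  rcases hdiv (g + g') (K.add_mem hg hg'K) hTc with h0 | ⟨T, hT⟩
  · exfalso
    have hneg : g' = -g := eq_neg_of_add_eq_zero_right h0
    have hgsq : g * g = 0 := by rw [hneg, mul_neg, neg_eq_zero] at hgg'; exact hgg'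
    have hback : volumeElement c u * (volumeElement c u * g) = g := by
      rw [← mul_assoc, hω, one_mul]
    rcases hdiv (volumeElement c u * g) (K.mul_mem hωK hg) (by
      intro v
      rw [mul_assoc, h1, hneg, ← mul_assoc, ← mul_assoc, hc.mul_volumeElement u]
      noncomm_ring) with h | h
    · apply hg0'
      rw [← hback, h, mul_zero]
    · have : volumeElement c u * g * g = 0 := by rw [mul_assoc, hgsq, mul_zero]
      exact hg0' (h.mul_right_eq_zero.1 this)
  · have hcomm : (T : R) * g = g * T := by rw [hT, add_mul, mul_add, hgg', hg'g]
    have hcomm' : (↑T⁻¹ : R) * g = g * ↑T⁻¹ := by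
      have : Commute (T : R) g := hcomm
      exact this.units_inv_left
    have hcv : ∀ v, (↑T⁻¹ : R) * c v = c v * ↑T⁻¹ := by
      intro v
      have : Commute (T : R) (c v) := by rw [hT]; exact hTc v
      exact this.units_inv_left
    have hgsq : g * g = T * g := by rw [hT, add_mul, hg'g, add_zero]
    refine ⟨T, ↑T⁻¹, ↑T⁻¹ * g, ↑T⁻¹ * g', T.mul_inv, T.inv_mul, ?_, ?_, ?_, ?_, ?_, ?_, ?_, ?_⟩
    · rw [mul_assoc, ← mul_assoc g, ← hcomm', mul_assoc, hgsq, T.inv_mul_cancel_left]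
    · rw [← mul_add, ← hT, T.inv_mul]
    · intro h
      rw [Units.mul_right_eq_zero] at h
      exact hg0' h
    · rw [hT]; exact hTc
    · rw [T.mul_inv_cancel_left, mul_assoc, ← hcomm, T.inv_mul_cancel_left]
    · rw [T.mul_inv_cancel_left]
    · rw [T.mul_inv_cancel_left]
    · intro v
      rw [← mul_assoc, ← hcv, mul_assoc, ← h2, mul_assoc]

end Core

/-! ### The two off-diagonal corners, and scalarity of `B`. -/

section Core

variable {E : Type*} [NormedAddCommGroup E] [InnerProductSpace ℝ E]
variable {R : Type*} [Ring R] [Algebra ℝ R] {c : E →ₗ[ℝ] R}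

theorem add_self_injective {x y : R} (h : x + x = y + y) : x = y := by
  rw [← two_smul ℝ, ← two_smul ℝ] at h
  exact smul_right_injective R (two_ne_zero (α := ℝ)) h

/-- The off-diagonal blocks, with respect to an idempotent `π` with `c v * π = (1 - π) * c v`, of
the equation `2 α v δ - α² v - v δ² - β γ v - v γ β = B v`. -/
theorem exists_corner_of_relations
    {T S π π' α β δ : R} (hTS : T * S = 1) (hST : S * T = 1) (hπ : π * π = π) (hππ' : π + π' = 1)
    (hTc : ∀ v, T * c v = c v * T) (hTπ : T * π = π * T) (hcπ : ∀ v, c v * π = π' * c v)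
    (B : E → E)
    (h1 : T * π' * δ = α * (T * π'))
    (h2 : ∀ v, T * π * c v * δ + T * π * c v * δ = (T * π * α + δ * (T * π)) * c v)
    (h3 : ∀ v, α * c v * δ + α * c v * δ - α * α * c v - c v * δ * δ - β * (T * π) * c v
      - c v * (T * π) * β = c (B v)) :
    ∃ C : R, C * π = C ∧ (∀ v, C * c v = π * c (B v)) ∧
      ∀ v, c v * c v = 1 → c v * (T * C * S) = c (B v) * π := by
  obtain rfl : π' = 1 - π := eq_sub_of_add_eq' hππ'
  set π' := 1 - π with hπ'
  have hππ0 : π * π' = 0 := by rw [hπ', mul_sub, hπ]; simp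
  have hππ0' : π' * π = 0 := by rw [hπ', sub_mul, hπ]; simp
  have hcπ' : ∀ v, c v * π' = π * c v := by
    intro v
    rw [hπ', mul_sub, hcπ, hπ']; noncomm_ring
  have hSc : ∀ v, S * c v = c v * S := by
    intro v
    calc S * c v = S * (c v * T) * S := by simp only [mul_assoc, hTS, mul_one]
      _ = c v * S := by rw [← hTc, ← mul_assoc, hST, one_mul]
  have hTπ' : T * π' = π' * T := by rw [hπ', mul_sub, sub_mul, hTπ, mul_one, one_mul]
  -- By `h1`, `α` maps the image of `π'` into itself and `δ` maps the kernel of `π'` into itself.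
  have f1 : π * α * π' = 0 := by
    calc π * α * π' = π * (α * (T * π')) * S := by
          rw [hTπ']; simp only [mul_assoc, hTS, mul_one]
      _ = 0 := by rw [← h1, hTπ', ← mul_assoc, ← mul_assoc, hππ0]; simp
  have f2 : π' * δ * π = 0 := by
    calc π' * δ * π = S * (T * π' * δ) * π := by
          simp only [← mul_assoc, hST, one_mul]
      _ = 0 := by rw [h1]; simp only [mul_assoc, hππ0', mul_zero]
  obtain ⟨a, ha⟩ : ∃ a, a = π * α := ⟨_, rfl⟩
  obtain ⟨d, hd⟩ : ∃ d, d = δ * π := ⟨_, rfl⟩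
  obtain ⟨A, hA⟩ : ∃ A, A = π' * δ := ⟨_, rfl⟩
  obtain ⟨A', hA'⟩ : ∃ A', A' = α * π' := ⟨_, rfl⟩
  have haπ : a * π = a := by
    rw [ha]; linear_combination (norm := noncomm_ring) π * α * hππ' - f1
  have hπd : π * d = d := by
    rw [hd]; linear_combination (norm := noncomm_ring) hππ' * (δ * π) - f2
  have hdπ : d * π = d := by rw [hd, mul_assoc, hπ]
  have hAπ' : A * π' = A := by
    rw [hA]; linear_combination (norm := noncomm_ring) π' * δ * hππ' - f2
  have hπ'A' : π' * A' = A' := by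
    rw [hA']; linear_combination (norm := noncomm_ring) hππ' * (α * π') - f1
  have hTA : T * A = A' * T := by
    rw [hA, ← mul_assoc, h1, hTπ', hA', mul_assoc]
  have hA'T : A' = T * A * S := by rw [hTA, mul_assoc, hTS, mul_one]
  -- `M` is the mean of the `π`-corner of `α` and the `T`-conjugated `π`-corner of `δ`. Relation
  -- `h2` says that vectors intertwine it with the `π'`-corner `A` of `δ`, so only `a`, `M` and `β`
  -- remain as unknowns.
  obtain ⟨M, hM⟩ : ∃ M, M = (1 / 2 : ℝ) • (a + S * d * T) := ⟨_, rfl⟩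
  have hMM : M + M = a + S * d * T := by
    rw [hM, ← two_smul ℝ, smul_smul]; norm_num
  have hMπ : M * π = M := by
    rw [hM, smul_mul_assoc, add_mul, haπ, mul_assoc _ T, hTπ, ← mul_assoc, mul_assoc S, hdπ]
  have hdM : d = T * (M + M - a) * S := by
    rw [hMM, add_sub_cancel_left]
    calc d = (T * S) * d * (T * S) := by rw [hTS]; simp
      _ = _ := by simp only [mul_assoc]
  have hcA : ∀ v, c v * A = M * c v := by
    intro v
    apply add_self_injective
    have hMc : M * c v + M * c v = (a + S * d * T) * c v := by rw [← hMM, add_mul]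
    rw [hMc]
    have e1 : c v * A = S * (T * π * c v * δ) := by
      simp only [← mul_assoc, hST, one_mul]
      rw [← hcπ', hA, mul_assoc]
    rw [e1, ← mul_add, h2, ha, hd, hTπ]
    have e2 : S * (π * T * α) = π * α := by
      rw [← hTπ, ← mul_assoc, ← mul_assoc, hST, one_mul]
    linear_combination (norm := noncomm_ring) e2 * c v
  -- `t1` to `t6` compress the terms of `h3` by `π · π'`, and `s1` to `s6` by `π' · π`.
  have t1 : ∀ v, π * (α * c v * δ) * π' = a * M * c v := by
    intro v
    calc π * (α * c v * δ) * π' = a * π * c v * δ * π' := by rw [haπ, ha]; noncomm_ring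
      _ = a * (c v * A) * π' := by rw [mul_assoc a, ← hcπ', hA]; noncomm_ring
      _ = a * M * (c v * π') := by rw [hcA]; noncomm_ring
      _ = a * (M * π) * c v := by rw [hcπ']; noncomm_ring
      _ = _ := by rw [hMπ]
  have t2 : ∀ v, π * (α * α * c v) * π' = a * a * c v := by
    intro v
    calc π * (α * α * c v) * π' = a * π * α * (c v * π') := by rw [haπ, ha]; noncomm_ring
      _ = a * ((π * α) * π) * c v := by rw [hcπ']; noncomm_ring
      _ = _ := by rw [← ha, haπ]
  have t3 : ∀ v, π * (c v * δ * δ) * π' = M * M * c v := by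
    intro v
    calc π * (c v * δ * δ) * π' = (π * c v) * δ * δ * π' := by noncomm_ring
      _ = c v * (A * π') * δ * π' := by rw [hAπ', ← hcπ', hA]; noncomm_ring
      _ = c v * A * (A * π') := by rw [hA]; noncomm_ring
      _ = M * c v * A := by rw [hAπ', hcA]
      _ = _ := by rw [mul_assoc, hcA, mul_assoc]
  have t4 : ∀ v, π * (β * (T * π) * c v) * π' = π * β * T * π * c v := by
    intro v
    calc π * (β * (T * π) * c v) * π' = π * β * T * π * (c v * π') := by noncomm_ring
      _ = π * β * T * (π * π) * c v := by rw [hcπ']; noncomm_ring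
      _ = _ := by rw [hπ]
  have t5 : ∀ v, π * (c v * (T * π) * β) * π' = 0 := by
    intro v
    calc π * (c v * (T * π) * β) * π' = (π * c v) * (T * π) * β * π' := by noncomm_ring
      _ = c v * (π' * T) * π * β * π' := by rw [← hcπ']; noncomm_ring
      _ = c v * T * (π' * π) * β * π' := by rw [← hTπ']; noncomm_ring
      _ = 0 := by rw [hππ0']; simp
  have t6 : ∀ v, π * c v * π' = π * c v := by
    intro v; rw [mul_assoc, hcπ', ← mul_assoc, hπ]
  have s1 : ∀ v, π' * (α * c v * δ) * π = A' * c v * d := by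
    intro v
    calc π' * (α * c v * δ) * π = π' * α * c v * (π * d) := by rw [hπd, hd]; noncomm_ring
      _ = π' * α * (c v * π) * d := by noncomm_ring
      _ = π' * A' * c v * d := by rw [hcπ, hA']; noncomm_ring
      _ = _ := by rw [hπ'A']
  have s2 : ∀ v, π' * (α * α * c v) * π = A' * A' * c v := by
    intro v
    calc π' * (α * α * c v) * π = π' * α * α * (c v * π) := by noncomm_ring
      _ = π' * α * A' * c v := by rw [hcπ, hA']; noncomm_ring
      _ = π' * α * (π' * A') * c v := by rw [hπ'A']
      _ = (π' * A') * A' * c v := by rw [hA']; noncomm_ring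
      _ = _ := by rw [hπ'A']
  have s3 : ∀ v, π' * (c v * δ * δ) * π = c v * d * d := by
    intro v
    calc π' * (c v * δ * δ) * π = (π' * c v) * δ * d := by rw [hd]; noncomm_ring
      _ = c v * π * δ * (π * d) := by rw [← hcπ, hπd]
      _ = c v * (π * d) * d := by rw [hd]; noncomm_ring
      _ = _ := by rw [hπd]
  have s4 : ∀ v, π' * (β * (T * π) * c v) * π = 0 := by
    intro v
    calc π' * (β * (T * π) * c v) * π = π' * β * T * π * (c v * π) := by noncomm_ring
      _ = π' * β * T * (π * π') * c v := by rw [hcπ]; noncomm_ring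
      _ = _ := by rw [hππ0]; simp
  have s5 : ∀ v, π' * (c v * (T * π) * β) * π = c v * (T * (π * β * T * π) * S) := by
    intro v
    calc π' * (c v * (T * π) * β) * π = (π' * c v) * (T * π) * β * π := by noncomm_ring
      _ = c v * (π * T) * π * β * π := by rw [← hcπ]; noncomm_ring
      _ = c v * T * (π * π) * β * π := by rw [← hTπ]; noncomm_ring
      _ = c v * T * π * β * (π * T) * S := by
        rw [hπ, mul_assoc _ _ S, mul_assoc π, hTS, mul_one]
      _ = _ := by rw [← hTπ]; noncomm_ring
  have s6 : ∀ v, π' * c v * π = c v * π := by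
    intro v; rw [← hcπ, mul_assoc, hπ]
  -- The first corner gives this element directly. The second, conjugated back by `T`, gives `2M(2M
  -- - a) - M² - (2M - a)²` in place of `2aM - a² - M²`; the two expressions agree even without
  -- commutativity.
  refine ⟨a * M + a * M - a * a - M * M - π * β * T * π, ?_, ?_, ?_⟩
  · simp only [sub_mul, add_mul, mul_assoc, hMπ, haπ, hπ]
  · intro v
    have := congrArg (fun y => π * y * π') (h3 v)
    simp only [mul_sub, mul_add, sub_mul, add_mul, t1, t2, t3, t4, t5, t6, sub_zero] at this
    rw [← this]
    noncomm_ring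
  · intro v hv
    have := congrArg (fun y => π' * y * π) (h3 v)
    simp only [mul_sub, mul_add, sub_mul, add_mul, s1, s2, s3, s4, s5, s6, sub_zero] at this
    rw [← this]
    have hAc : A * c v = c v * M := by
      calc A * c v = c v * (c v * A) * c v := by rw [← mul_assoc, hv, one_mul]
        _ = c v * M * (c v * c v) := by rw [hcA]; noncomm_ring
        _ = _ := by rw [hv, mul_one]
    have hA'c : A' * c v = c v * (T * M * S) := by
      calc A' * c v = T * A * (S * c v) := by rw [hA'T]; noncomm_ring
        _ = T * (A * c v) * S := by rw [hSc]; noncomm_ring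
        _ = (T * c v) * M * S := by rw [hAc]; noncomm_ring
        _ = _ := by rw [hTc]; noncomm_ring
    have key : ∀ x y : R, T * x * S * (T * y * S) = T * (x * y) * S := by
      intro x y
      calc T * x * S * (T * y * S) = T * x * (S * T) * y * S := by noncomm_ring
        _ = _ := by rw [hST]; noncomm_ring
    have k1 : A' * c v * d = c v * (T * (M * (M + M - a)) * S) := by
      rw [hA'c, hdM, mul_assoc, key]
    have k2 : A' * A' * c v = c v * (T * (M * M) * S) := by
      rw [mul_assoc, hA'c, ← mul_assoc, hA'c, mul_assoc, key]
    have k3 : c v * d * d = c v * (T * ((M + M - a) * (M + M - a)) * S) := by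
      rw [hdM, mul_assoc, key]
    rw [k1, k2, k3]
    noncomm_ring

/-- If `C v = π (B v)` and `v C = (B v) π` for all unit vectors `v`, then `B` is a multiple of the
identity. -/
theorem eq_smul_id_of_corner (hc : IsClifford c) {π C : R} (hπ0 : π ≠ 0)
    (hcπ : ∀ v, c v * π = (1 - π) * c v) (B : End ℝ E)
    (h1 : ∀ v, C * c v = π * c (B v)) (h2 : ∀ v, c v * c v = 1 → c v * C = c (B v) * π) :
    ∃ k : ℝ, B = k • LinearMap.id := by
  have hcc : ∀ v w, π * (c v * c w) = c v * c w * π := by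
    intro v w
    rw [mul_assoc (c v), hcπ, sub_mul, one_mul, mul_sub, ← mul_assoc (c v) π, hcπ]
    noncomm_ring
  -- `C` equals both `π (B v) v` and `π v (B v)`, so the Clifford relation evaluates `2C`. Then `π`
  -- annihilates the vector `B v - (v, B v) v`, which must be zero because a vector squares to its
  -- squared norm and `π ≠ 0`.
  have key : ∀ v : E, ‖v‖ = 1 → B v = (inner ℝ v (B v) : ℝ) • v ∧ C = (inner ℝ v (B v) : ℝ) • π := by
    intro v hv
    have hvv := hc.mul_self_of_unit hv
    have hC : C = π * (c (B v) * c v) := by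
      rw [← mul_assoc, ← h1, mul_assoc, hvv, mul_one]
    have hC' : C = π * (c v * c (B v)) := by
      rw [hcc, mul_assoc, ← h2 v hvv, ← mul_assoc, hvv, one_mul]
    have hCk : C = (inner ℝ v (B v) : ℝ) • π := by
      apply add_self_injective
      nth_rewrite 1 [hC]
      rw [hC', ← mul_add, add_comm (c (B v) * c v), hc, mul_smul_comm, mul_one, ← add_smul,
        two_mul]
    refine ⟨?_, hCk⟩
    have h0 : π * c (B v - (inner ℝ v (B v) : ℝ) • v) = 0 := by
      rw [map_sub, mul_sub, ← h1, hCk, map_smul, smul_mul_assoc, mul_smul_comm, sub_self]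
    have h3 := congrArg (· * c (B v - (inner ℝ v (B v) : ℝ) • v)) h0
    simp only [mul_assoc, hc.mul_self, zero_mul, mul_smul_comm, mul_one] at h3
    rcases smul_eq_zero.1 h3 with h | h
    · exact sub_eq_zero.1 (inner_self_eq_zero.1 h)
    · exact absurd h hπ0
  by_cases hE : ∃ v : E, v ≠ 0
  · obtain ⟨v₀, hv₀⟩ := hE
    have hunit : ∀ v : E, v ≠ 0 → ‖(‖v‖⁻¹ : ℝ) • v‖ = 1 := fun v hv => norm_smul_inv_norm hv
    set k := (inner ℝ ((‖v₀‖⁻¹ : ℝ) • v₀) (B ((‖v₀‖⁻¹ : ℝ) • v₀)) : ℝ) with hk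
    refine ⟨k, LinearMap.ext fun v => ?_⟩
    by_cases hv : v = 0
    · simp [hv]
    · have e1 := key _ (hunit v hv)
      have e0 := (key _ (hunit v₀ hv₀)).2
      have : (inner ℝ ((‖v‖⁻¹ : ℝ) • v) (B ((‖v‖⁻¹ : ℝ) • v)) : ℝ) = k :=
        smul_left_injective ℝ hπ0 (e1.2.symm.trans e0)
      rw [this] at e1
      have h := e1.1
      rw [map_smul, smul_comm] at h
      exact smul_right_injective E (inv_ne_zero (norm_ne_zero_iff.2 hv)) h
  · push Not at hE
    exact ⟨0, LinearMap.ext fun v => by simp [hE v]⟩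

/-- The matrix form of the relations of the Cahen-Wallach algebra, for the block matrix `(α β; γ δ)`
representing `𝐪` and the block matrix `(0 z; 0 0)` representing `𝐩`, force `B` to be a multiple of
the identity. -/
theorem exists_eq_smul_id_of_relations (hc : IsClifford c) (u : OrthonormalBasis (Fin 8) ℝ E)
    (K : Subalgebra ℝ R) (hcK : ∀ v, c v ∈ K)
    (hdiv : ∀ T ∈ K, (∀ v, T * c v = c v * T) → T = 0 ∨ IsUnit T)
    (B : End ℝ E) {α β γ δ z : R} (hγK : γ ∈ K) (hz : z ≠ 0) (hzγ : z * γ = 0) (hγz : γ * z = 0)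
    (hzδ : z * δ = α * z)
    (h1 : ∀ v w, c w * γ * c v + c v * γ * c w = -((inner ℝ v w : ℝ) • z))
    (h2 : ∀ v, γ * c v * δ + γ * c v * δ = (γ * α + δ * γ) * c v)
    (h3 : ∀ v, α * c v * δ + α * c v * δ - α * α * c v - c v * δ * δ - β * γ * c v
      - c v * γ * β = c (B v)) :
    ∃ k : ℝ, B = k • LinearMap.id := by
  -- The case `w = v` of `h1`, halved; it makes `-z/2` the partner of `γ` under conjugation by
  -- vectors.
  have hconj : ∀ v, c v * γ * c v = (inner ℝ v v : ℝ) • ((-(1 / 2) : ℝ) • z) := by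
    intro v
    apply add_self_injective
    rw [h1, ← two_smul ℝ, smul_smul, smul_smul, ← neg_smul]
    congr 1
    ring
  obtain ⟨γ', hγ'⟩ : ∃ γ', γ' = (-(1 / 2) : ℝ) • z := ⟨_, rfl⟩
  have hcancel : ∀ (v : E), v ≠ 0 → ∀ {x y : R}, (inner ℝ v v : ℝ) • x = (inner ℝ v v : ℝ) • y →
      x = y := fun v hv _ _ h => smul_right_injective R (inner_self_ne_zero.2 hv) h
  rw [← hγ'] at hconj
  have g1 : ∀ v, γ * c v = c v * γ' := by
    intro v
    by_cases hv : v = 0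
    · simp [hv]
    · apply hcancel v hv
      calc (inner ℝ v v : ℝ) • (γ * c v) = c v * c v * (γ * c v) := by
            rw [hc.mul_self, smul_mul_assoc, one_mul]
        _ = c v * (c v * γ * c v) := by noncomm_ring
        _ = _ := by rw [hconj, mul_smul_comm]
  have g2 : ∀ v, γ' * c v = c v * γ := by
    intro v
    by_cases hv : v = 0
    · simp [hv]
    · apply hcancel v hv
      rw [← smul_mul_assoc, ← hconj, mul_assoc, hc.mul_self, mul_smul_comm, mul_one]
  obtain ⟨T, S, π, π', hTS, hST, hπ, hππ', hπ0, hTc, hTπ, rfl, hgT', hcπ⟩ :=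
    exists_idempotent_of_swap hc u K hcK hdiv hγK (g := γ) (g' := γ')
      (by rw [hγ']; exact smul_ne_zero (by norm_num) hz)
      (by rw [hγ', mul_smul_comm, hγz, smul_zero]) (by rw [hγ', smul_mul_assoc, hzγ, smul_zero])
      g1 g2
  obtain ⟨C, hCπ, hC1, hC2⟩ := exists_corner_of_relations hTS hST hπ hππ' hTc hTπ hcπ B
    (by rw [← hgT', hγ', smul_mul_assoc, hzδ, mul_smul_comm]) h2 h3
  obtain rfl : π' = 1 - π := eq_sub_of_add_eq' hππ'
  refine eq_smul_id_of_corner hc hπ0 hcπ B hC1 fun v hv => ?_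
  have hC : C = π * c (B v) * c v := by rw [← hC1, mul_assoc, hv, mul_one]
  -- `T` commutes with `π` and with vectors, hence with `C = π (B v) v`; the conjugation by `T` in
  -- the second corner therefore disappears.
  have hTC : T * C = C * T := by
    calc T * C = (T * π) * c (B v) * c v := by rw [hC]; noncomm_ring
      _ = π * (T * c (B v)) * c v := by rw [hTπ]; noncomm_ring
      _ = π * c (B v) * (T * c v) := by rw [hTc]; noncomm_ring
      _ = _ := by rw [hTc, hC]; noncomm_ring
  rw [← hC2 v hv, hTC, mul_assoc C, hTS, mul_one]

end Core

/-! ### Matrix units and entries in an abstract ring. -/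

section MatrixUnits

variable {A : Type*} [Ring A] {n : Type*} [Fintype n]

/-- A system of matrix units in a ring. -/
structure IsMatrixUnits [DecidableEq n] (e : n → n → A) : Prop where
  mul : ∀ i j k l, e i j * e k l = if j = k then e i l else 0
  sum : ∑ i, e i i = 1

/-- The matrix entries of a ring element with respect to a system of matrix units; they commute with
the matrix units. -/
def matrixEntry (e : n → n → A) (i j : n) (a : A) : A := ∑ k, e k i * a * e j k

variable {e : n → n → A}

theorem matrixEntry_sub (i j : n) (a b : A) :
    matrixEntry e i j (a - b) = matrixEntry e i j a - matrixEntry e i j b := by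
  simp [matrixEntry, mul_sub, sub_mul]

theorem matrixEntry_smul [Algebra ℝ A] (i j : n) (r : ℝ) (a : A) :
    matrixEntry e i j (r • a) = r • matrixEntry e i j a := by
  simp [matrixEntry, Finset.smul_sum]

variable [DecidableEq n]

/-- Insert `1 = ∑ j, e j j` between the factors. -/
theorem IsMatrixUnits.matrixEntry_mul (he : IsMatrixUnits e) (i l : n) (a b : A) :
    matrixEntry e i l (a * b) = ∑ j, matrixEntry e i j a * matrixEntry e j l b := by
  have h : ∀ j, matrixEntry e i j a * matrixEntry e j l b = ∑ k, e k i * a * e j j * (b * e l k) := by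
    intro j
    rw [matrixEntry, matrixEntry, Finset.sum_mul]
    refine Finset.sum_congr rfl fun k _ => ?_
    rw [Finset.mul_sum, Finset.sum_eq_single k]
    · calc e k i * a * e j k * (e k j * b * e l k) = e k i * a * (e j k * e k j) * (b * e l k) := by
            simp only [mul_assoc]
        _ = _ := by rw [he.mul, if_pos rfl]
    · intro m _ hm
      calc e k i * a * e j k * (e m j * b * e l m) = e k i * a * (e j k * e m j) * (b * e l m) := by
            simp only [mul_assoc]
        _ = _ := by rw [he.mul, if_neg (Ne.symm hm)]; simp
    · simp
  simp only [h]
  rw [Finset.sum_comm, matrixEntry]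
  refine Finset.sum_congr rfl fun k _ => ?_
  rw [← Finset.sum_mul, ← Finset.mul_sum, he.sum, mul_one, mul_assoc, mul_assoc, mul_assoc]

theorem IsMatrixUnits.commute_matrixEntry (he : IsMatrixUnits e) (i j k l : n) (a : A) :
    e k l * matrixEntry e i j a = matrixEntry e i j a * e k l := by
  rw [matrixEntry, Finset.mul_sum, Finset.sum_mul, Finset.sum_eq_single l, Finset.sum_eq_single k]
  · rw [← mul_assoc, ← mul_assoc, he.mul, if_pos rfl, mul_assoc _ (e j k), he.mul, if_pos rfl]
  · intro m _ hm
    rw [mul_assoc _ (e j m), he.mul, if_neg hm, mul_zero]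
  · simp
  · intro m _ hm
    rw [← mul_assoc, ← mul_assoc, he.mul, if_neg (Ne.symm hm), zero_mul, zero_mul]
  · simp

theorem IsMatrixUnits.matrixEntry_mul_unit (he : IsMatrixUnits e) (i j k l : n) {x : A}
    (hx : ∀ k l, e k l * x = x * e k l) :
    matrixEntry e i j (x * e k l) = if i = k ∧ j = l then x else 0 := by
  rw [matrixEntry]
  have h : ∀ m, e m i * (x * e k l) * e j m = x * if i = k ∧ j = l then e m m else 0 := by
    intro m
    rw [← mul_assoc, hx, mul_assoc, mul_assoc, he.mul, mul_ite, mul_zero, he.mul]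
    by_cases hik : i = k <;> by_cases hjl : j = l <;> simp [hik, hjl, @eq_comm _ l j]
  simp only [h]
  rw [← Finset.mul_sum]
  split_ifs
  · rw [he.sum, mul_one]
  · simp

/-- Each Peirce component `e i i * a * e j j` is the `(i, j)` entry times `e i j`, and `a` is the
sum of its components. -/
theorem IsMatrixUnits.eq_zero_of_matrixEntry (he : IsMatrixUnits e) {a : A}
    (h : ∀ i j, matrixEntry e i j a = 0) : a = 0 := by
  have key : ∀ i j, e i i * a * e j j = 0 := by
    intro i j
    have : matrixEntry e i j a * e i j = e i i * a * e j j := by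
      rw [matrixEntry, Finset.sum_mul, Finset.sum_eq_single i]
      · rw [mul_assoc, he.mul, if_pos rfl]
      · intro m _ hm
        rw [mul_assoc, he.mul, if_neg hm, mul_zero]
      · simp
    rw [← this, h, zero_mul]
  calc a = (∑ i, e i i) * a * ∑ j, e j j := by rw [he.sum]; simp
    _ = 0 := by simp only [Finset.sum_mul, Finset.mul_sum, key, Finset.sum_const_zero]

end MatrixUnits

/-! ### Clifford frames: from the representation to 2 × 2 matrix relations. -/

section Frames

variable {E : Type*} [NormedAddCommGroup E] [InnerProductSpace ℝ E]
variable {A : Type*} [Ring A] [Algebra ℝ A]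

/-- The relations satisfied by the images of `E`, `𝐩` and `𝐪` under a representation of `Cl(𝔪)`. -/
structure IsCliffordFrame (i : E →ₗ[ℝ] A) (P Q : A) : Prop where
  clifford : IsClifford i
  p_sq : P * P = 0
  q_sq : Q * Q = 0
  pq : P * Q + Q * P = (-2 : ℝ) • 1
  vec_p : ∀ v, i v * P = -(P * i v)
  vec_q : ∀ v, i v * Q = -(Q * i v)

/-- The matrix units attached to a pair of isotropic vectors. -/
noncomputable def isotropicUnits (P Q : A) : Fin 2 → Fin 2 → A :=
  ![![(-(1 / 2) : ℝ) • (P * Q), (1 / 2 : ℝ) • P], ![-Q, (-(1 / 2) : ℝ) • (Q * P)]]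

variable {i : E →ₗ[ℝ] A} {P Q : A}

theorem IsCliffordFrame.pqp (h : IsCliffordFrame i P Q) : P * Q * P = (-2 : ℝ) • P := by
  have := congrArg (· * P) h.pq
  simpa [add_mul, mul_assoc, h.p_sq] using this

theorem IsCliffordFrame.qpq (h : IsCliffordFrame i P Q) : Q * P * Q = (-2 : ℝ) • Q := by
  have := congrArg (· * Q) h.pq
  simpa [add_mul, mul_assoc, h.q_sq] using this

theorem IsCliffordFrame.isMatrixUnits (h : IsCliffordFrame i P Q) :
    IsMatrixUnits (isotropicUnits P Q) := by
  have h1 := h.pqp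
  have h2 := h.qpq
  rw [mul_assoc] at h1 h2
  have h3 (x : A) : P * (P * x) = 0 := by rw [← mul_assoc, h.p_sq, zero_mul]
  have h4 (x : A) : Q * (Q * x) = 0 := by rw [← mul_assoc, h.q_sq, zero_mul]
  constructor
  · intro a b c d
    fin_cases a <;> fin_cases b <;> fin_cases c <;> fin_cases d <;>
      simp [isotropicUnits, mul_assoc, h1, h2, h3, h4, h.p_sq, h.q_sq, smul_smul]
  · simp only [Fin.sum_univ_two, isotropicUnits]
    simp only [Matrix.cons_val_zero, Matrix.cons_val_one]
    rw [← smul_add, h.pq, smul_smul]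
    norm_num

/-- The Clifford map `e ↦ (e 0; 0 e)` attached to `e ↦ (-e 0; 0 e)`. -/
noncomputable def diagonalMap (i : E →ₗ[ℝ] A) (P Q : A) : E →ₗ[ℝ] A :=
  LinearMap.mulRight ℝ (isotropicUnits P Q 1 1 - isotropicUnits P Q 0 0) ∘ₗ i

theorem diagonalMap_apply (v : E) : diagonalMap i P Q v =
    i v * (isotropicUnits P Q 1 1 - isotropicUnits P Q 0 0) := rfl

/-- Diagonal units are even in the isotropic vectors and off-diagonal ones are odd. The twist by
`e₁₁ - e₀₀` in `diagonalMap` cancels exactly this sign. -/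
theorem IsCliffordFrame.units_mul_vec (h : IsCliffordFrame i P Q) (v : E) (a b : Fin 2) :
    isotropicUnits P Q a b * i v = (if a = b then (1 : ℝ) else -1) • (i v * isotropicUnits P Q a b) := by
  have hP : P * i v = -(i v * P) := by rw [h.vec_p, neg_neg]
  have hQ : Q * i v = -(i v * Q) := by rw [h.vec_q, neg_neg]
  fin_cases a <;> fin_cases b <;> simp [isotropicUnits, mul_assoc, hP, hQ] <;>
    simp [← mul_assoc, hP, hQ]

theorem IsCliffordFrame.sign_sq (h : IsCliffordFrame i P Q) :
    (isotropicUnits P Q 1 1 - isotropicUnits P Q 0 0) *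
      (isotropicUnits P Q 1 1 - isotropicUnits P Q 0 0) = 1 := by
  have he := h.isMatrixUnits
  rw [← he.sum]
  simp [mul_sub, sub_mul, he.mul, Fin.sum_univ_two, add_comm]

theorem IsCliffordFrame.sign_comm (h : IsCliffordFrame i P Q) (v : E) :
    (isotropicUnits P Q 1 1 - isotropicUnits P Q 0 0) * i v =
      i v * (isotropicUnits P Q 1 1 - isotropicUnits P Q 0 0) := by
  simp [mul_sub, sub_mul, h.units_mul_vec]

theorem IsCliffordFrame.isClifford_diagonalMap (h : IsCliffordFrame i P Q) :
    IsClifford (diagonalMap i P Q) := by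
  have key : ∀ v w, diagonalMap i P Q v * diagonalMap i P Q w = i v * i w := by
    intro v w
    rw [diagonalMap_apply, diagonalMap_apply, mul_assoc (i v), ← mul_assoc _ (i w), h.sign_comm,
      mul_assoc (i w), h.sign_sq, mul_one]
  intro v w
  rw [key, key, h.clifford]

theorem IsCliffordFrame.units_mul_diagonalMap (h : IsCliffordFrame i P Q) (v : E) (a b : Fin 2) :
    isotropicUnits P Q a b * diagonalMap i P Q v = diagonalMap i P Q v * isotropicUnits P Q a b := by
  have he := h.isMatrixUnits
  rw [diagonalMap_apply, ← mul_assoc, h.units_mul_vec, smul_mul_assoc, mul_assoc, mul_assoc]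
  fin_cases a <;> fin_cases b <;> simp [mul_sub, sub_mul, he.mul]

theorem IsCliffordFrame.diagonalMap_mul_unit (h : IsCliffordFrame i P Q) (v : E) :
    diagonalMap i P Q v * isotropicUnits P Q 0 1 = (1 / 2 : ℝ) • (P * i v) := by
  have he := h.isMatrixUnits
  rw [← h.units_mul_diagonalMap, diagonalMap_apply, ← mul_assoc, h.units_mul_vec, smul_mul_assoc, mul_assoc,
    mul_sub, he.mul, he.mul]
  have : P * i v = -(i v * P) := by rw [h.vec_p, neg_neg]
  simp [this, isotropicUnits]

/-- A spin representation of non-zero charge, restricted to the generators of the Cahen-Wallach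
algebra, forces `B` to be a multiple of the identity. -/
theorem IsCliffordFrame.exists_eq_smul_id (h : IsCliffordFrame i P Q)
    (u : OrthonormalBasis (Fin 8) ℝ E)
    (hdiv : ∀ T, T * P = P * T → T * Q = Q * T → (∀ v, T * i v = i v * T) → T = 0 ∨ IsUnit T)
    (B : End ℝ E) (hB : Function.Surjective B) (X : E → A) (Z K : A) (hZ : Z ≠ 0)
    (hNX : ∀ v w, (1 / 2 : ℝ) • (P * i (B v)) * X w - X w * (1 / 2 : ℝ) • (P * i (B v)) =
      (inner ℝ (B v) w : ℝ) • Z)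
    (hNK : ∀ v, (1 / 2 : ℝ) • (P * i (B v)) * K - K * (1 / 2 : ℝ) • (P * i (B v)) = X (B v))
    (hKX : ∀ v, K * X v - X v * K = (1 / 2 : ℝ) • (P * i (B v)))
    (hZK : Z * K = K * Z) :
    ∃ k : ℝ, B = k • LinearMap.id := by
  have he := h.isMatrixUnits
  have hcomm := h.units_mul_diagonalMap
  obtain ⟨c, hc⟩ : ∃ c, c = diagonalMap i P Q := ⟨_, rfl⟩
  have hcc : IsClifford c := hc ▸ h.isClifford_diagonalMap
  obtain ⟨N, hN'⟩ : ∃ N : E → A, ∀ v, N v = c v * isotropicUnits P Q 0 1 := ⟨_, fun _ => rfl⟩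
  have hN : ∀ v, (1 / 2 : ℝ) • (P * i v) = N v := by
    intro v
    rw [hN', hc, h.diagonalMap_mul_unit]
  have hiv : ∀ v, i v = c v * (isotropicUnits P Q 1 1 - isotropicUnits P Q 0 0) := by
    intro v
    rw [hc, diagonalMap_apply, mul_assoc, h.sign_sq, mul_one]
  have hP : P = (2 : ℝ) • isotropicUnits P Q 0 1 := by simp [isotropicUnits, smul_smul]
  have hQ : Q = -isotropicUnits P Q 1 0 := by simp [isotropicUnits]
  rw [← hc] at hcomm
  simp only [hN] at hNX hNK hKX
  -- Surjectivity of `B` turns statements about `B v` into statements about all of `E`.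
  have hX : ∀ v, X v = N v * K - K * N v := by
    intro v
    obtain ⟨w, rfl⟩ := hB v
    exact (hNK w).symm
  have hNX' : ∀ v w, N v * X w - X w * N v =
      (inner ℝ v w : ℝ) • Z := by
    intro v w
    obtain ⟨v, rfl⟩ := hB v
    exact hNX v w
  obtain ⟨m, hm⟩ : ∃ m, m = matrixEntry (isotropicUnits P Q) := ⟨_, rfl⟩
  have hmmul : ∀ a b x y, m a b (x * y) = m a 0 x * m 0 b y + m a 1 x * m 1 b y := by
    intro a b x y; rw [hm, he.matrixEntry_mul, Fin.sum_univ_two]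
  have hmsub : ∀ a b x y, m a b (x - y) = m a b x - m a b y := by
    intro a b x y; rw [hm, matrixEntry_sub]
  have hmN : ∀ a b v, m a b (N v) =
      if a = 0 ∧ b = 1 then c v else 0 := by
    intro a b v; rw [hm, hN', he.matrixEntry_mul_unit _ _ _ _ fun k l => hcomm v k l]
  have x00 : ∀ v, m 0 0 (X v) = c v * m 1 0 K := by
    intro v; rw [hX, hmsub, hmmul, hmmul]; simp [hmN]
  have x01 : ∀ v, m 0 1 (X v) = c v * m 1 1 K - m 0 0 K * c v := by
    intro v; rw [hX, hmsub, hmmul, hmmul]; simp [hmN]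
  have x10 : ∀ v, m 1 0 (X v) = 0 := by
    intro v; rw [hX, hmsub, hmmul, hmmul]; simp [hmN]
  have x11 : ∀ v, m 1 1 (X v) = -(m 1 0 K * c v) := by
    intro v; rw [hX, hmsub, hmmul, hmmul]; simp [hmN]
  have hu : (inner ℝ (u 0) (u 0) : ℝ) = 1 := by
    rw [real_inner_self_eq_norm_sq, u.orthonormal.1]; norm_num
  have hZu := hNX' (u 0) (u 0)
  rw [hu, one_smul] at hZu
  have z00 : m 0 0 Z = 0 := by
    rw [← hZu, hmsub, hmmul, hmmul]; simp [hmN, x10]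
  have z10 : m 1 0 Z = 0 := by
    rw [← hZu, hmsub, hmmul, hmmul]; simp [hmN]
  have z11 : m 1 1 Z = 0 := by
    rw [← hZu, hmsub, hmmul, hmmul]; simp [hmN, x10]
  have hz : m 0 1 Z ≠ 0 := by
    intro h0
    refine hZ (he.eq_zero_of_matrixEntry fun a b => ?_)
    rw [← hm]
    fin_cases a <;> fin_cases b
    exacts [z00, h0, z10, z11]
  have zk : ∀ a b, m a b (Z * K) = m a b (K * Z) := fun a b => by rw [hZK]
  -- The centralizer of 𝐩 and 𝐪 contains all matrix entries. An element of it that commutes with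
  -- every `c v` commutes with the whole frame, which is what Schur's lemma requires.
  refine exists_eq_smul_id_of_relations hcc u (Subalgebra.centralizer ℝ {P, Q})
    (fun v => ?_) (fun T hT hTc => ?_) B (α := m 0 0 K) (β := m 0 1 K) (γ := m 1 0 K)
    (δ := m 1 1 K) (z := m 0 1 Z) ?_ hz ?_ ?_ ?_ ?_ ?_ ?_
  · rw [Subalgebra.mem_centralizer_iff]
    rintro x (rfl | rfl)
    · rw [hP, smul_mul_assoc, mul_smul_comm, hcomm]
    · rw [hQ, neg_mul, mul_neg, hcomm]
  · rw [Subalgebra.mem_centralizer_iff] at hT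
    have hTP := hT P (by simp)
    have hTQ := hT Q (by simp)
    have hsgn : T * (isotropicUnits P Q 1 1 - isotropicUnits P Q 0 0) =
        (isotropicUnits P Q 1 1 - isotropicUnits P Q 0 0) * T := by
      have e1 : T * (P * Q) = P * Q * T := by
        rw [← mul_assoc, ← hTP, mul_assoc, ← hTQ, mul_assoc]
      have e2 : T * (Q * P) = Q * P * T := by
        rw [← mul_assoc, ← hTQ, mul_assoc, ← hTP, mul_assoc]
      simp [isotropicUnits, mul_add, add_mul, e1, e2]
    refine hdiv T hTP.symm hTQ.symm fun v => ?_
    rw [hiv, ← mul_assoc, hTc, mul_assoc, hsgn, mul_assoc]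
  · rw [Subalgebra.mem_centralizer_iff, hm]
    rintro x (rfl | rfl)
    · nth_rewrite 1 [hP]
      nth_rewrite 4 [hP]
      rw [smul_mul_assoc, mul_smul_comm, he.commute_matrixEntry]
    · nth_rewrite 1 [hQ]
      nth_rewrite 4 [hQ]
      rw [neg_mul, mul_neg, he.commute_matrixEntry]
  · have := zk 0 0
    rw [hmmul, hmmul] at this
    simpa [z00, z10] using this
  · have := zk 1 1
    rw [hmmul, hmmul] at this
    simpa [z11, z10] using this.symm
  · have := zk 0 1
    rw [hmmul, hmmul] at this
    simpa [z00, z11] using this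
  · intro v w
    have := congrArg (m 0 1) (hNX' v w)
    rw [hmsub, hmmul, hmmul, hm, matrixEntry_smul, ← hm] at this
    rw [← this]
    simp [hmN, x00, x11]
    noncomm_ring
  · intro v
    have := congrArg (m 1 1) (hKX v)
    rw [hmsub, hmmul, hmmul, hmN, x01, x10, x11] at this
    simp only [zero_mul, zero_add, one_ne_zero, false_and, if_false] at this
    linear_combination (norm := noncomm_ring) this
  · intro v
    have := congrArg (m 0 1) (hKX v)
    rw [hmsub, hmmul, hmmul, hmN, x00, x01, x11] at this
    simp only [true_and, if_true] at this
    linear_combination (norm := noncomm_ring) this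

end Frames

/-! ### Construction of representations from generators and matrix units. -/

section Existence

variable {E : Type*} [NormedAddCommGroup E] [InnerProductSpace ℝ E] [FiniteDimensional ℝ E]
variable {A : Type*} [Ring A] [Algebra ℝ A]

open CWAlgebra

/-- A representation of the Cahen-Wallach algebra, given on generators. -/
theorem exists_lieHom_of_relations (b : CWForm E) (N X : E →ₗ[ℝ] A) (Z K : A)
    (hNN : ∀ v w, ⁅N v, N w⁆ = 0) (hNX : ∀ v w, ⁅N v, X w⁆ = b.form v w • Z)
    (hNK : ∀ v, ⁅N v, K⁆ = X (b.endo v)) (hXX : ∀ v w, ⁅X v, X w⁆ = 0)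
    (hKX : ∀ v, ⁅K, X v⁆ = N v) (hZN : ∀ v, ⁅Z, N v⁆ = 0) (hZX : ∀ v, ⁅Z, X v⁆ = 0)
    (hZK : ⁅Z, K⁆ = 0) :
    ∃ ρ : CWAlgebra b →ₗ⁅ℝ⁆ A, (∀ e, ρ (ofDual (flat E e)) = N e) ∧ (∀ e, ρ (ofVec e) = X e) ∧
      ρ (p b) = Z ∧ ρ (q b) = K := by
  have hXN : ∀ v w, ⁅X v, N w⁆ = -(b.form w v • Z) := fun v w => by rw [← lie_skew, hNX]
  have hKN : ∀ v, ⁅K, N v⁆ = -X (b.endo v) := fun v => by rw [← lie_skew, hNK]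
  have hXK : ∀ v, ⁅X v, K⁆ = -N v := fun v => by rw [← lie_skew, hKX]
  have hNZ : ∀ v, ⁅N v, Z⁆ = 0 := fun v => by rw [← lie_skew, hZN, neg_zero]
  have hXZ : ∀ v, ⁅X v, Z⁆ = 0 := fun v => by rw [← lie_skew, hZX, neg_zero]
  have hKZ : ⁅K, Z⁆ = 0 := by rw [← lie_skew, hZK, neg_zero]
  let f : CWAlgebra b →ₗ[ℝ] A :=
    { toFun := fun x => N ((flat E).symm x.dual) + X x.vec + x.pc • Z + x.qc • K
      map_add' := fun x y => by
        simp only [dual_add, vec_add, pc_add, qc_add, map_add, add_smul]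
        abel
      map_smul' := fun r x => by
        simp [smul_smul] }
  refine ⟨{ f with map_lie' := ?_ }, fun e => ?_, fun e => ?_, ?_, ?_⟩
  · intro x y
    change N ((flat E).symm ⁅x, y⁆.dual) + X ⁅x, y⁆.vec + ⁅x, y⁆.pc • Z + ⁅x, y⁆.qc • K =
      ⁅N ((flat E).symm x.dual) + X x.vec + x.pc • Z + x.qc • K,
        N ((flat E).symm y.dual) + X y.vec + y.pc • Z + y.qc • K⁆
    simp only [add_lie, lie_add, smul_lie, lie_smul, hNN, hNX, hNK, hXX, hKX, hZN, hZX, hZK, hXN,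
      hKN, hXK, hNZ, hXZ, hKZ, lie_self, smul_zero, bracket_def, dual_mk, vec_mk, pc_mk, qc_mk,
      map_sub, map_smul, LinearEquiv.symm_apply_apply, sub_smul, zero_smul, smul_neg]
    module
  · change N ((flat E).symm (flat E e)) + X 0 + (0 : ℝ) • Z + (0 : ℝ) • K = N e
    simp
  · change N ((flat E).symm 0) + X e + (0 : ℝ) • Z + (0 : ℝ) • K = X e
    simp
  · change N ((flat E).symm 0) + X 0 + (1 : ℝ) • Z + (0 : ℝ) • K = Z
    simp
  · change N ((flat E).symm 0) + X 0 + (0 : ℝ) • Z + (1 : ℝ) • K = K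
    simp

/-- The explicit block matrices for `B = ε • id`; `a` and `a'` are the semi-spinor projections. -/
theorem exists_lieHom_of_matrixUnits (b : CWForm E) {ε : ℝ}
    (hb : b.endo = ε • LinearMap.id) {f : Fin 2 → Fin 2 → A} (hf : IsMatrixUnits f)
    {c : E →ₗ[ℝ] A} (hc : IsClifford c) (hfc : ∀ i j v, f i j * c v = c v * f i j)
    {a a' : A} (hfa : ∀ i j, f i j * a = a * f i j) (hfa' : ∀ i j, f i j * a' = a' * f i j)
    (hsum : a + a' = 1) (haa' : a * a' = 0) (ha'a : a' * a = 0)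
    (hca : ∀ v, c v * a = a' * c v) (hca' : ∀ v, c v * a' = a * c v) :
    ∃ ρ : CWAlgebra b →ₗ⁅ℝ⁆ A, (∀ e, ρ (ofDual (flat E e)) = √2 • (c (b.endo e) * f 0 1)) ∧
      (∀ e, ρ (ofVec e) = √2 • (c e * a * f 1 1 - c e * a' * f 0 0)) ∧
      ρ (p b) = (4 : ℝ) • (a * f 0 1) ∧ ρ (q b) = ε • f 0 1 - a' * f 1 0 := by
  have r1 (i j v x) : f i j * (c v * x) = c v * (f i j * x) := by
    rw [← mul_assoc, hfc, mul_assoc]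
  have r2 (i j x) : f i j * (a * x) = a * (f i j * x) := by rw [← mul_assoc, hfa, mul_assoc]
  have r3 (i j x) : f i j * (a' * x) = a' * (f i j * x) := by rw [← mul_assoc, hfa', mul_assoc]
  have r4 (x) : a * (a' * x) = 0 := by rw [← mul_assoc, haa', zero_mul]
  have r5 (x) : a' * (a * x) = 0 := by rw [← mul_assoc, ha'a, zero_mul]
  have r6 (v x) : c v * (a * x) = a' * (c v * x) := by rw [← mul_assoc, hca, mul_assoc]
  have r7 (v x) : c v * (a' * x) = a * (c v * x) := by rw [← mul_assoc, hca', mul_assoc]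
  have hcc (v w x) : c v * (c w * x) = (2 * inner ℝ v w : ℝ) • x - c w * (c v * x) := by
    rw [← mul_assoc, eq_sub_of_add_eq (hc v w), sub_mul, smul_mul_assoc, one_mul, mul_assoc]
  have h2 : √2 * √2 = 2 := Real.mul_self_sqrt (by norm_num)
  have hB : ∀ v, b.endo v = ε • v := fun v => by rw [hb]; simp
  have hform : ∀ v w, b.form v w = ε * inner ℝ v w := by
    intro v w
    rw [b.form_eq, hB, scalarE_apply, inner_smul_left]; simp
  let N : E →ₗ[ℝ] A := √2 • (LinearMap.mulRight ℝ (f 0 1) ∘ₗ c ∘ₗ b.endo)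
  let X : E →ₗ[ℝ] A := √2 • (LinearMap.mulRight ℝ (a * f 1 1 - a' * f 0 0) ∘ₗ c)
  have hN : ∀ v, N v = √2 • (ε • (c v * f 0 1)) := by
    intro v; simp [N, hB]
  have hX : ∀ v, X v = √2 • (c v * (a * f 1 1 - a' * f 0 0)) := fun v => rfl
  have hX' : ∀ e, √2 • (c e * a * f 1 1 - c e * a' * f 0 0) = X e := fun e => by
    rw [hX, mul_sub, mul_assoc, mul_assoc]
  simp only [hX']
  refine exists_lieHom_of_relations b N X ((4 : ℝ) • (a * f 0 1)) (ε • f 0 1 - a' * f 1 0)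
    ?_ ?_ ?_ ?_ ?_ ?_ ?_ ?_
  · intro v w
    simp [hN, LieRing.of_associative_ring_bracket, mul_assoc, r1, hf.mul]
  · intro v w
    simp only [hN, hX, hform, LieRing.of_associative_ring_bracket, mul_assoc, mul_sub, sub_mul,
      smul_mul_assoc, mul_smul_comm, r1, r2, r3, r6, r7, hf.mul, smul_sub]
    simp only [if_true, one_ne_zero, if_false, mul_zero, smul_zero, sub_zero, zero_sub,
      sub_neg_eq_add]
    -- The bracket contains both orders of `v` and `w`; the Clifford relation reduces their sum to a
    -- scalar.
    have hvw : a * (c v * (c w * f 0 1)) =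
        (2 * inner ℝ v w : ℝ) • (a * f 0 1) - a * (c w * (c v * f 0 1)) := by
      rw [hcc, mul_sub, mul_smul_comm]
    rw [hvw]
    match_scalars
    · linear_combination 2 * ε * inner ℝ v w * h2
    · ring
  · intro v
    simp only [hN, hX, hB, LieRing.of_associative_ring_bracket, mul_assoc, mul_sub, sub_mul,
      smul_mul_assoc, mul_smul_comm, r1, r3, r6, r7, hf.mul, smul_sub, map_smul]
    simp only [if_true, one_ne_zero, if_false, mul_zero, smul_zero, zero_sub]
    module
  · intro v w
    simp [hX, LieRing.of_associative_ring_bracket, mul_assoc, mul_sub, sub_mul,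
      r1, r2, r3, r4, r5, r6, r7, hf.mul, smul_sub]
  · intro v
    simp [hN, hX, LieRing.of_associative_ring_bracket, mul_assoc, mul_sub, sub_mul,
      r1, r2, r3, r5, r6, r7, hf.mul, smul_sub]
    have hv : a * (c v * f 0 1) + a' * (c v * f 0 1) = c v * f 0 1 := by
      rw [← add_mul, hsum, one_mul]
    rw [smul_comm ε, ← smul_add, ← smul_add, add_comm, hv]
  · intro v
    simp [hN, LieRing.of_associative_ring_bracket, mul_assoc, r1, r2, hf.mul]
  · intro v
    simp [hX, LieRing.of_associative_ring_bracket, mul_assoc, mul_sub, sub_mul,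
      r1, r2, r3, r4, r6, r7, hf.mul, smul_sub]
  · simp [LieRing.of_associative_ring_bracket, mul_assoc, mul_sub, sub_mul, r2, r3, r4, r5, hf.mul]

end Existence

/-! ### Semi-spinor projections and the representation for `B = ε id`. -/

section Existence

variable {E : Type*} [NormedAddCommGroup E] [InnerProductSpace ℝ E]
variable {A : Type*} [Ring A] [Algebra ℝ A] {i : E →ₗ[ℝ] A} {P Q : A}

theorem IsCliffordFrame.rescale (h : IsCliffordFrame i P Q) {r : ℝ} (hr : r ≠ 0) :
    IsCliffordFrame i (r⁻¹ • P) (r • Q) where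
  clifford := h.clifford
  p_sq := by simp [h.p_sq]
  q_sq := by simp [h.q_sq]
  pq := by
    rw [smul_mul_smul_comm, smul_mul_smul_comm, inv_mul_cancel₀ hr, mul_inv_cancel₀ hr, one_smul,
      one_smul, h.pq]
  vec_p v := by simp [h.vec_p]
  vec_q v := by simp [h.vec_q]

/-- The projection `½ (1 + s ω)` defined by the volume element `ω`. -/
noncomputable def chiralProj (c : E →ₗ[ℝ] A) (u : OrthonormalBasis (Fin 8) ℝ E) (s : ℝ) : A :=
  (1 / 2 : ℝ) • (1 + s • volumeElement c u)

variable {c : E →ₗ[ℝ] A} (u : OrthonormalBasis (Fin 8) ℝ E)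

theorem chiralProj_add : chiralProj c u 1 + chiralProj c u (-1) = 1 := by
  simp only [chiralProj]
  module

theorem IsClifford.chiralProj_mul (hc : IsClifford c) :
    chiralProj c u 1 * chiralProj c u (-1) = 0 ∧ chiralProj c u (-1) * chiralProj c u 1 = 0 := by
  have hω := hc.volumeElement_mul_self u
  constructor <;> simp only [chiralProj, mul_add, add_mul, smul_mul_assoc, mul_smul_comm, hω,
    one_mul, mul_one] <;> module

theorem IsClifford.mul_chiralProj (hc : IsClifford c) (v : E) (s : ℝ) :
    c v * chiralProj c u s = chiralProj c u (-s) * c v := by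
  simp [chiralProj, mul_add, add_mul, hc.mul_volumeElement]

theorem commute_chiralProj {x : A} (hx : ∀ v, x * c v = c v * x) (s : ℝ) :
    x * chiralProj c u s = chiralProj c u s * x := by
  have : x * volumeElement c u = volumeElement c u * x := by
    refine (Commute.list_prod_right _ _ fun y hy => ?_).eq
    obtain ⟨j, rfl⟩ := (List.mem_ofFn' _ _).1 hy
    exact hx _
  simp [chiralProj, mul_add, add_mul, this]

theorem IsCliffordFrame.chiralProj_mul_unit_ne_zero [Nontrivial A] (h : IsCliffordFrame i P Q) :
    chiralProj (diagonalMap i P Q) u 1 * isotropicUnits P Q 0 1 ≠ 0 := by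
  intro h0
  have he := h.isMatrixUnits
  have hC := h.isClifford_diagonalMap
  have hcomm := fun a b => commute_chiralProj u (fun v => h.units_mul_diagonalMap v a b) 1
  set a := chiralProj (diagonalMap i P Q) u 1 with ha
  have ha0 : a = 0 := by
    -- As `a` commutes with the units, this is `a (e₀₁ e₁₀ + e₁₀ e₀₁) = a`. If `a = 0`, the
    -- complementary projection is `1`, and exchanging the two makes a unit vector zero although its
    -- square is `1`.
    calc a = a * isotropicUnits P Q 0 1 * isotropicUnits P Q 1 0 +
          isotropicUnits P Q 1 0 * (a * isotropicUnits P Q 0 1) := by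
          rw [← mul_assoc (isotropicUnits P Q 1 0), hcomm, mul_assoc, mul_assoc, ← mul_add, he.mul,
            he.mul, if_pos rfl, if_pos rfl, ← Fin.sum_univ_two fun i => isotropicUnits P Q i i,
            he.sum, mul_one]
      _ = 0 := by rw [h0]; simp
  have h1 := hC.mul_chiralProj u (u 0) 1
  have h2 : chiralProj (diagonalMap i P Q) u (-1) = 1 := by
    rw [← chiralProj_add (c := diagonalMap i P Q) u, ← ha, ha0, zero_add]
  rw [← ha, ha0, h2, mul_zero, one_mul] at h1
  have h3 := hC.mul_self_of_unit (u.orthonormal.1 0)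
  rw [← h1, mul_zero] at h3
  exact zero_ne_one h3

variable [FiniteDimensional ℝ E]

open CWAlgebra

theorem IsCliffordFrame.exists_lieHom (h : IsCliffordFrame i P Q) (b : CWForm E) {ε : ℝ}
    (hb : b.endo = ε • LinearMap.id) {f : Fin 2 → Fin 2 → A} (hf : f = isotropicUnits P Q)
    (hc : c = diagonalMap i P Q) :
    ∃ ρ : CWAlgebra b →ₗ⁅ℝ⁆ A, (∀ e, ρ (ofDual (flat E e)) = √2 • (c (b.endo e) * f 0 1)) ∧
      (∀ e, ρ (ofVec e) =
        √2 • (c e * chiralProj c u 1 * f 1 1 - c e * chiralProj c u (-1) * f 0 0)) ∧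
      ρ (p b) = (4 : ℝ) • (chiralProj c u 1 * f 0 1) ∧
      ρ (q b) = ε • f 0 1 - chiralProj c u (-1) * f 1 0 := by
  subst hf hc
  have hC := h.isClifford_diagonalMap
  exact exists_lieHom_of_matrixUnits b hb h.isMatrixUnits hC
    (fun a b v => h.units_mul_diagonalMap v a b)
    (fun a b => commute_chiralProj u (fun v => h.units_mul_diagonalMap v a b) _)
    (fun a b => commute_chiralProj u (fun v => h.units_mul_diagonalMap v a b) _)
    (chiralProj_add u) (hC.chiralProj_mul u).1 (hC.chiralProj_mul u).2
    (fun v => hC.mul_chiralProj u v _) (fun v => by rw [hC.mul_chiralProj u v, neg_neg])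

end Existence

/-! ### Schur's lemma, and reduction from the Clifford algebra to its generators. -/

section Irreducible

variable {A S : Type*} [Ring A] [Algebra ℝ A] [AddCommGroup S] [Module ℝ S]

/-- Schur's lemma. -/
theorem IsIrreducible.eq_zero_or_isUnit {γ : A →ₐ[ℝ] End ℝ S} (h : IsIrreducible γ) {T : End ℝ S}
    (hT : ∀ a, T * γ a = γ a * T) : T = 0 ∨ IsUnit T := by
  have hT' : ∀ a x, T (γ a x) = γ a (T x) := fun a x => LinearMap.congr_fun (hT a) x
  rcases h.2 (LinearMap.ker T) (by
    intro a x hx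
    rw [LinearMap.mem_ker] at hx ⊢
    rw [hT', hx, map_zero]) with hk | hk
  · rcases h.2 (LinearMap.range T) (by
      rintro a _ ⟨x, rfl⟩
      exact ⟨γ a x, hT' a x⟩) with hr | hr
    · exact Or.inl (LinearMap.range_eq_bot.1 hr)
    · exact Or.inr ((Module.End.isUnit_iff T).2
        ⟨LinearMap.ker_eq_bot.1 hk, LinearMap.range_eq_top.1 hr⟩)
  · exact Or.inl (LinearMap.ker_eq_top.1 hk)

variable {M : Type*} [AddCommGroup M] [Module ℝ M] {q : QuadraticForm ℝ M}

theorem cliffordAlgebra_invariant (γ : CliffordAlgebra q →ₐ[ℝ] End ℝ S) (W : Submodule ℝ S)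
    (h : ∀ v, ∀ x ∈ W, γ (CliffordAlgebra.ι q v) x ∈ W) (a : CliffordAlgebra q) :
    ∀ x ∈ W, γ a x ∈ W := by
  induction a using CliffordAlgebra.induction with
  | algebraMap r =>
    intro x hx
    rw [AlgHom.commutes, Module.algebraMap_end_apply]
    exact W.smul_mem r hx
  | ι v => exact h v
  | mul a b ha hb =>
    intro x hx
    rw [map_mul]
    exact ha _ (hb x hx)
  | add a b ha hb =>
    intro x hx
    rw [map_add]
    exact W.add_mem (ha x hx) (hb x hx)

theorem cliffordAlgebra_commute (γ : CliffordAlgebra q →ₐ[ℝ] End ℝ S) {T : End ℝ S}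
    (h : ∀ v, T * γ (CliffordAlgebra.ι q v) = γ (CliffordAlgebra.ι q v) * T)
    (a : CliffordAlgebra q) : T * γ a = γ a * T := by
  induction a using CliffordAlgebra.induction with
  | algebraMap r => rw [AlgHom.commutes, Algebra.commutes]
  | ι v => exact h v
  | mul a b ha hb => rw [map_mul, ← mul_assoc, ha, mul_assoc, hb, mul_assoc]
  | add a b ha hb => rw [map_add, mul_add, add_mul, ha, hb]

end Irreducible

/-! ### The Clifford frame of a representation of `Cl(𝔪)`. -/

section ClM

variable {E : Type*} [NormedAddCommGroup E] [InnerProductSpace ℝ E]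
variable {A : Type*} [Ring A] [Algebra ℝ A] (φ : ClM E →ₐ[ℝ] A)

/-- The restriction to `E` of a representation of `Cl(𝔪)`. -/
noncomputable def vecMap : E →ₗ[ℝ] A := φ.toLinearMap ∘ₗ inM ∘ₗ LinearMap.inl ℝ E (ℝ × ℝ)

theorem vecMap_apply (v : E) : vecMap φ v = φ (inM (v, 0, 0)) := rfl

theorem map_inM_mul_add (x y : Minkowski E) :
    φ (inM x) * φ (inM y) + φ (inM y) * φ (inM x) = (-2 * scalarM E x y) • (1 : A) := by
  have hsymm : scalarM E y x = scalarM E x y := by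
    simp only [scalarM, LinearMap.mk₂_apply, scalarE_apply, real_inner_comm]; ring
  have h := CliffordAlgebra.ι_mul_ι_add_swap (Q := -(scalarM E).toQuadraticMap) x y
  rw [← map_mul φ, ← map_mul φ, ← map_add φ]
  have : QuadraticMap.polar (-(scalarM E).toQuadraticMap) x y = -2 * scalarM E x y := by
    simp [QuadraticMap.polar, hsymm]; ring
  rw [inM, h, this, AlgHom.commutes, Algebra.algebraMap_eq_smul_one]

theorem eq_zero_of_add_self {x : A} (h : x + x = 0) : x = 0 := by
  apply add_self_injective
  simpa using h

theorem isCliffordFrame :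
    IsCliffordFrame (vecMap φ) (φ (inM vecP)) (φ (inM (0, 0, 1))) where
  clifford v w := by
    rw [vecMap_apply, vecMap_apply, map_inM_mul_add]
    simp [scalarM]
  p_sq := eq_zero_of_add_self (by rw [map_inM_mul_add]; simp [scalarM, vecP])
  q_sq := eq_zero_of_add_self (by rw [map_inM_mul_add]; simp [scalarM])
  pq := by rw [map_inM_mul_add]; simp [scalarM, vecP]
  vec_p v := eq_neg_of_add_eq_zero_left (by
    rw [vecMap_apply, map_inM_mul_add]; simp [scalarM, vecP])
  vec_q v := eq_neg_of_add_eq_zero_left (by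
    rw [vecMap_apply, map_inM_mul_add]; simp [scalarM])

theorem map_inM (x : Minkowski E) :
    φ (inM x) = vecMap φ x.1 + x.2.1 • φ (inM vecP) + x.2.2 • φ (inM (0, 0, 1)) := by
  rw [vecMap_apply, ← map_smul, ← map_smul, ← map_add, ← map_smul, ← map_smul, ← map_add, ← map_add,
    ← map_add]
  congr 2
  ext <;> simp [vecP]

theorem map_wedge (v : E) :
    φ (wedge vecP (v, 0, 0)) = (1 / 2 : ℝ) • (φ (inM vecP) * vecMap φ v) := by
  have h := (isCliffordFrame φ).vec_p v
  rw [wedge, map_smul, map_sub, map_mul, map_mul, ← vecMap_apply, h]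
  module

end ClM

/-! ### Necessity and existence on a Clifford module. -/

section Charge

variable {E : Type*} [NormedAddCommGroup E] [InnerProductSpace ℝ E] [FiniteDimensional ℝ E]

open CWAlgebra

/-- The kernel of `B` lies in the radical of `b`, and `E` is finite-dimensional. -/
theorem CWForm.endo_surjective (b : CWForm E) : Function.Surjective b.endo := by
  rw [← LinearMap.injective_iff_surjective, ← LinearMap.ker_eq_bot, LinearMap.ker_eq_bot']
  intro v hv
  refine b.nondegenerate.1 v fun w => ?_
  rw [b.form_eq, hv]
  simp

variable {S : Type*} [AddCommGroup S] [Module ℝ S]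

theorem HasNonzeroChargeSpinRep.exists_endo_eq {b : CWForm E} {ρspin : ClM E →ₐ[ℝ] End ℝ S}
    (u : OrthonormalBasis (Fin 8) ℝ E) (hirr : IsIrreducible ρspin)
    (h : HasNonzeroChargeSpinRep b ρspin) : ∃ k : ℝ, b.endo = k • LinearMap.id := by
  obtain ⟨ρ, hspin, hp⟩ := h
  have hN : ∀ v, (1 / 2 : ℝ) • (ρspin (inM vecP) * vecMap ρspin (b.endo v)) =
      ρ (ofDual (flat E v)) := fun v => by rw [hspin, map_wedge]
  refine (isCliffordFrame ρspin).exists_eq_smul_id u (fun T hTP hTQ hTv => ?_) b.endo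
    b.endo_surjective (fun v => ρ (ofVec v)) (ρ (p b)) (ρ (q b)) hp ?_ ?_ ?_ ?_
  · refine hirr.eq_zero_or_isUnit (cliffordAlgebra_commute ρspin fun x => ?_)
    change T * ρspin (inM x) = ρspin (inM x) * T
    rw [map_inM]
    simp [mul_add, add_mul, hTP, hTQ, hTv]
  · intro v w
    rw [hN, ← LieRing.of_associative_ring_bracket, ← LieHom.map_lie, ← map_smul ρ]
    congr 1
    ext1 <;> simp [bracket_def, ofDual, ofVec, p, b.form_eq]
  · intro v
    rw [hN, ← LieRing.of_associative_ring_bracket, ← LieHom.map_lie]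
    congr 1
    ext1 <;> simp [bracket_def, ofDual, ofVec, q]
  · intro v
    rw [hN, ← LieRing.of_associative_ring_bracket, ← LieHom.map_lie]
    congr 1
    ext1 <;> simp [bracket_def, ofDual, ofVec, q]
  · rw [← sub_eq_zero, ← LieRing.of_associative_ring_bracket, ← LieHom.map_lie, ← map_zero ρ]
    congr 1
    ext1 <;> simp [bracket_def, p, q]

/-- The explicit spin representation for `B = ε • id`, written in terms of matrix units of the Clifford
module. -/
theorem exists_spinRep [Nontrivial S] (u : OrthonormalBasis (Fin 8) ℝ E) (b : CWForm E) {ε : ℝ}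
    (hb : b.endo = ε • LinearMap.id) (ρspin : ClM E →ₐ[ℝ] End ℝ S)
    {f : Fin 2 → Fin 2 → End ℝ S} {c : E →ₗ[ℝ] End ℝ S}
    (hf : f = isotropicUnits ((√2)⁻¹ • ρspin (inM vecP)) (√2 • ρspin (inM (0, 0, 1))))
    (hc : c = diagonalMap (vecMap ρspin) ((√2)⁻¹ • ρspin (inM vecP))
      (√2 • ρspin (inM (0, 0, 1)))) :
    ∃ ρ : CWAlgebra b →ₗ⁅ℝ⁆ End ℝ S, IsSpin ρspin ρ ∧ ρ (p b) ≠ 0 ∧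
      (∀ e, ρ (ofDual (flat E e)) = √2 • (c (b.endo e) * f 0 1)) ∧
      (∀ e, ρ (ofVec e) =
        √2 • (c e * chiralProj c u 1 * f 1 1 - c e * chiralProj c u (-1) * f 0 0)) ∧
      ρ (p b) = (4 : ℝ) • (chiralProj c u 1 * f 0 1) ∧
      ρ (q b) = ε • f 0 1 - chiralProj c u (-1) * f 1 0 := by
  have h2 : √2 ≠ 0 := by positivity
  -- Rescaling 𝐩 and 𝐪 inversely keeps the frame relations. The factor `√2` makes the units standard
  -- in the block model and produces the `√2` in `ρ(e♭)`.
  have hframe := (isCliffordFrame ρspin).rescale h2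
  obtain ⟨ρ, h1, h3, h4, h5⟩ := hframe.exists_lieHom u b hb hf hc
  refine ⟨ρ, fun e => ?_, ?_, h1, h3, h4, h5⟩
  · rw [h1, map_wedge, hf, hc, hframe.diagonalMap_mul_unit, smul_mul_assoc, smul_comm (√2),
      smul_inv_smul₀ h2]
  · rw [h4, hf, hc]
    exact smul_ne_zero (by norm_num) (hframe.chiralProj_mul_unit_ne_zero u)

end Charge

/-! ### The block model `V ⊕ V`. -/

section Model

variable {E : Type*} [NormedAddCommGroup E] [InnerProductSpace ℝ E]
variable {V : Type*} [AddCommGroup V] [Module ℝ V]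

theorem block_mul (a b c d a' b' c' d' : End ℝ V) : block a b c d * block a' b' c' d' =
    block (a * a' + b * c') (a * b' + b * d') (c * a' + d * c') (c * b' + d * d') := by
  ext x <;> simp

theorem block_smul (r : ℝ) (a b c d : End ℝ V) :
    r • block a b c d = block (r • a) (r • b) (r • c) (r • d) := by
  ext x <;> simp

theorem block_add (a b c d a' b' c' d' : End ℝ V) : block a b c d + block a' b' c' d' =
    block (a + a') (b + b') (c + c') (d + d') := by
  ext x <;> simp

theorem block_neg (a b c d : End ℝ V) : -block a b c d = block (-a) (-b) (-c) (-d) := by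
  ext x <;> simp

theorem block_sub (a b c d a' b' c' d' : End ℝ V) : block a b c d - block a' b' c' d' =
    block (a - a') (b - b') (c - c') (d - d') := by
  rw [sub_eq_add_neg, block_neg, block_add]; simp only [sub_eq_add_neg]

theorem block_one : (1 : End ℝ (V × V)) = block 1 0 0 1 := by
  ext x <;> simp

variable (γ : ClE E →ₐ[ℝ] End ℝ V)

theorem model_inM (v : Minkowski E) : model γ (inM v) = modelVec γ v :=
  CliffordAlgebra.lift_ι_apply _ _ v

/-- The actions of 𝐩 and 𝐪 carry each component into the other slot, so an invariant subspace has
the form `U ⊕ U` with `U` invariant under `Cl(E)`. -/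
theorem isIrreducible_model (hγ : IsIrreducible γ) : IsIrreducible (model γ) := by
  obtain ⟨hV, hirr⟩ := hγ
  refine ⟨inferInstance, fun W hW => ?_⟩
  have h2 : √2 ≠ 0 := by positivity
  have hvec : ∀ v : Minkowski E, ∀ x ∈ W, modelVec γ v x ∈ W := fun v x hx => by
    rw [← model_inM]; exact hW _ x hx
  have hfst : ∀ y ∈ W, (y.2, 0) ∈ W := by
    intro y hy
    have := W.smul_mem (2 * √2)⁻¹ (hvec (0, 1, 0) y hy)
    have hinv : (2 * √2)⁻¹ * (2 * √2) = 1 := inv_mul_cancel₀ (by positivity)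
    simpa [modelVec, smul_smul, -mul_inv_rev, hinv] using this
  have hsnd : ∀ y ∈ W, (0, y.1) ∈ W := by
    intro y hy
    have := W.smul_mem (-√2) (hvec (0, 0, 1) y hy)
    simpa [modelVec, smul_smul, h2] using this
  rcases hirr (W.comap (LinearMap.inl ℝ V V)) (cliffordAlgebra_invariant γ _ fun v x hx => by
    have := W.neg_mem (hvec (v, 0, 0) (x, 0) hx)
    simpa [modelVec, inE] using this) with h | h
  · left
    rw [eq_bot_iff] at h ⊢
    intro y hy
    have e1 : y.2 = 0 := h (hfst y hy)
    have e2 : y.1 = 0 := h (hfst _ (hsnd y hy))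
    exact Prod.ext e2 e1
  · right
    rw [eq_top_iff] at h ⊢
    intro y _
    have e1 : (y.1, (0 : V)) ∈ W := h (x := y.1) trivial
    have e2 : (y.2, (0 : V)) ∈ W := h (x := y.2) trivial
    have := W.add_mem e1 (hsnd _ e2)
    simpa using this

theorem isotropicUnits_model (a b : Fin 2) :
    isotropicUnits ((√2)⁻¹ • model γ (inM vecP)) (√2 • model γ (inM (0, 0, 1))) a b =
      block (if a = 0 ∧ b = 0 then 1 else 0) (if a = 0 ∧ b = 1 then 1 else 0)
        (if a = 1 ∧ b = 0 then 1 else 0) (if a = 1 ∧ b = 1 then 1 else 0) := by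
  have h2 : √2 ≠ 0 := by positivity
  have hP : (√2)⁻¹ • model γ (inM vecP) = block 0 ((2 : ℝ) • 1) 0 0 := by
    rw [model_inM, vecP]
    simp [modelVec, block_smul, smul_smul, h2, mul_comm]
  have hQ : √2 • model γ (inM (0, 0, 1)) = block 0 0 (-1) 0 := by
    rw [model_inM]
    simp [modelVec, block_smul, smul_smul, h2]
  rw [hP, hQ]
  fin_cases a <;> fin_cases b <;> simp [isotropicUnits, block_mul, block_smul, block_neg, smul_smul]

theorem diagonalMap_model (v : E) :
    diagonalMap (vecMap (model γ)) ((√2)⁻¹ • model γ (inM vecP)) (√2 • model γ (inM (0, 0, 1))) v =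
      block (γ (inE v)) 0 0 (γ (inE v)) := by
  rw [diagonalMap_apply, isotropicUnits_model, isotropicUnits_model, vecMap_apply, model_inM]
  simp [modelVec, block_mul, block_sub]

theorem chiralProj_of_block {c : E →ₗ[ℝ] End ℝ (V × V)}
    (hc : ∀ v, c v = block (γ (inE v)) 0 0 (γ (inE v))) (u : OrthonormalBasis (Fin 8) ℝ E) (s : ℝ) :
    chiralProj c u s = block (semiProj γ u s) 0 0 (semiProj γ u s) := by
  have key : ∀ l : List E, (l.map c).prod =
      block (γ (l.map inE).prod) 0 0 (γ (l.map inE).prod) := by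
    intro l
    induction l with
    | nil => simp [block_one]
    | cons v l ih => simp [ih, hc, block_mul]
  have hω : volumeElement c u = block (γ (List.ofFn fun i => inE (u i)).prod) 0 0
      (γ (List.ofFn fun i => inE (u i)).prod) := by
    have := key (List.ofFn u)
    rw [List.map_ofFn, List.map_ofFn] at this
    exact this
  rw [chiralProj, hω, block_one, semiProj]
  simp [block_smul, block_add]

end Model
end CahenWallach

open CahenWallach CahenWallach.CWAlgebra in
theorem theorem4p5
    {E : Type*} [NormedAddCommGroup E] [InnerProductSpace ℝ E] [FiniteDimensional ℝ E]
    (hdim : Module.finrank ℝ E = 8) (b : CWForm E)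
    (hnorm : LinearMap.trace ℝ E (b.endo ∘ₗ b.endo) = 8) :
    (∀ (S : Type*) [AddCommGroup S] [Module ℝ S] (ρspin : ClM E →ₐ[ℝ] Module.End ℝ S),
      IsIrreducible ρspin →
        (HasNonzeroChargeSpinRep b ρspin ↔
          b.endo = LinearMap.id ∨ b.endo = -LinearMap.id)) ∧
    (∀ (V : Type*) [AddCommGroup V] [Module ℝ V] (γ : ClE E →ₐ[ℝ] Module.End ℝ V),
      IsIrreducible γ →
        IsIrreducible (model γ) ∧
        ∀ (u : OrthonormalBasis (Fin 8) ℝ E) (ε : ℝ), ε = 1 ∨ ε = -1 →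
          b.endo = ε • LinearMap.id →
          ∃ ρ : CWAlgebra b →ₗ⁅ℝ⁆ Module.End ℝ (V × V),
            IsSpin (model γ) ρ ∧ ρ (p b) ≠ 0 ∧
            (∀ e : E, ρ (ofDual (flat E e)) = √2 • block 0 (γ (inE (b.endo e))) 0 0) ∧
            (∀ e : E, ρ (ofVec e) =
              √2 • block (-(γ (inE e) * semiProj γ u (-1))) 0 0 (γ (inE e) * semiProj γ u 1)) ∧
            ρ (p b) = (4 : ℝ) • block 0 (semiProj γ u 1) 0 0 ∧
            ρ (q b) = block 0 (ε • 1) (-semiProj γ u (-1)) 0) := by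
  have u : OrthonormalBasis (Fin 8) ℝ E := (stdOrthonormalBasis ℝ E).reindex (finCongr hdim)
  refine ⟨fun S _ _ ρspin hirr => ⟨fun h => ?_, fun h => ?_⟩, fun V _ _ γ hγ =>
    ⟨isIrreducible_model γ hγ, fun u ε _ hb => ?_⟩⟩
  · obtain ⟨k, hk⟩ := h.exists_endo_eq u hirr
    rw [hk] at hnorm ⊢
    -- The trace of `(k id)²` is `8 k²`.
    have hk2 : k * k = 1 := by
      have : LinearMap.trace ℝ E (LinearMap.id : E →ₗ[ℝ] E) = 8 := by
        rw [LinearMap.trace_id, hdim]; norm_num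
      rw [LinearMap.smul_comp, LinearMap.comp_smul, LinearMap.id_comp, map_smul, map_smul, this]
        at hnorm
      simp only [smul_eq_mul] at hnorm
      linarith
    rcases mul_self_eq_one_iff.1 hk2 with rfl | rfl
    · exact Or.inl (one_smul _ _)
    · exact Or.inr (by rw [neg_smul, one_smul])
  · have := hirr.1
    obtain ⟨ε, hb⟩ : ∃ ε : ℝ, b.endo = ε • LinearMap.id := by
      rcases h with h | h
      · exact ⟨1, by rw [h, one_smul]⟩
      · exact ⟨-1, by rw [h, neg_smul, one_smul]⟩
    obtain ⟨ρ, hspin, hp, -⟩ := exists_spinRep u b hb ρspin rfl rfl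
    exact ⟨ρ, hspin, hp⟩
  · have := hγ.1
    obtain ⟨ρ, hspin, hp, e1, e2, e3, e4⟩ := exists_spinRep u b hb (model γ) rfl rfl
    refine ⟨ρ, hspin, hp, fun e => ?_, fun e => ?_, ?_, ?_⟩
    · rw [e1, diagonalMap_model, isotropicUnits_model]
      simp [block_mul]
    · rw [e2, diagonalMap_model, isotropicUnits_model, isotropicUnits_model,
        chiralProj_of_block γ (diagonalMap_model γ), chiralProj_of_block γ (diagonalMap_model γ)]
      simp [block_mul, block_sub]
    · rw [e3, isotropicUnits_model, chiralProj_of_block γ (diagonalMap_model γ)]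
      simp [block_mul]
    · rw [e4, isotropicUnits_model, isotropicUnits_model,
        chiralProj_of_block γ (diagonalMap_model γ)]
      simp [block_mul, block_smul, block_sub]
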